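/- Let $M$ be a compact orientable smooth manifold of real dimension $2n$, $\mathrm{vol}$ a volume form on $M$ and $H$ a real closed $3$-form; put $d_H=d+H\wedge$. A section $e=X+\xi$ of $(T_M\oplus T_M^*)^{\mathbb C}$ acts on complex forms by $e\cdot\alpha=i_X\alpha+\xi\wedge\alpha$; put $\langle X+\xi,Y+\theta\rangle=\frac12(\xi(Y)+\theta(X))$, $\langle\alpha,\beta\rangle_s=(\alpha\wedge\sigma\beta)_{[2n]}$, where $\sigma$ is $+1$ in degrees $0,1$ and $-1$ in degrees $2,3$ modulo $4$, and $L^H_e=d_H\circ e+e\circ d_H$. Let $(\mathcal J_\phi,\mathcal J_\psi)$ be an almost generalized Kähler structure on $M$, i.e. a pair of commuting orthogonal endomorphisms of $T_M\oplus T_M^*$ with square $-1$ such that $\langle-\mathcal J_\phi\mathcal J_\psi e,e\rangle>0$ for $e\ne0$ (in particular, any $H$-twisted generalized Kähler structure). Let $\phi=\{\phi_\alpha\}$, $\psi=\{\psi_\alpha\}$ be smooth local trivializations, over an open cover $\{U_\alpha\}$ of $M$, of their canonical line bundles by nondegenerate pure spinors ($\mathcal J_\phi=-\sqrt{-1}$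 on $\ker\phi_\alpha$, $\mathcal J_\psi=-\sqrt{-1}$ on $\ker\psi_\alpha$), normalized by $i^{-n}\langle\phi_\alpha,\overline\phi_\alpha\rangle_s=i^{-n}\langle\psi_\alpha,\overline\psi_\alpha\rangle_s=\mathrm{vol}$. Write $d_H\phi_\alpha=(\eta_\alpha+N_\phi)\cdot\phi_\alpha$ and $d_H\psi_\alpha=(\zeta_\alpha+N_\psi)\cdot\psi_\alpha$ with $\eta_\alpha,\zeta_\alpha\in\sqrt{-1}(T_M\oplus T_M^*)$ and $N_\phi$, $N_\psi$ real sections of $\wedge^3(T_M\oplus T_M^*)$ of type $(3,0)+(0,3)$ with respect to $\mathcal J_\phi$, $\mathcal J_\psi$. The scalar curvature $S(\mathcal J_\phi,\mathcal J_\psi;\mathrm{vol})$ is the real function, independent of the normalized trivializations, given by $$S(\mathcal J_\phi,\mathcal J_\psi;\mathrm{vol})\,\mathrm{vol}=\mathrm{Re}\big(i^{-n}\langle\psi_\alpha,L^H_{\eta_\alpha}\overline\psi_\alpha\rangle_s+i^{-n}\langle\phi_\alpha,L^H_{\zeta_\alpha}\overline\phi_\alpha\rangle_s\big)+2\langle\zeta_\alpha,\eta_\alpha\rangle\,\mathrm{vol}.$$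 Let $\widetilde{\mathrm{Diff}}_0(M,H)$ be the group of all $g=e^bF$, with $F$ a diffeomorphism in the identity component of $\mathrm{Diff}(M)$ and $b$ a real $2$-form, such that the action $g\cdot\omega=e^b\wedge F^*\omega$ on differential forms satisfies $d_H\circ g=g\circ d_H$ (equivalently, $db=F^*H-H$). For every $g=e^bF\in\widetilde{\mathrm{Diff}}_0(M,H)$, the families $g\cdot\phi=\{e^b\wedge F^*\phi_\alpha\}$ and $g\cdot\psi=\{e^b\wedge F^*\psi_\alpha\}$ over the cover $\{F^{-1}(U_\alpha)\}$ are local trivializations, normalized by $F^*\mathrm{vol}$, of the canonical line bundles of an almost generalized Kähler structure $(\mathcal J_{g\cdot\phi},\mathcal J_{g\cdot\psi})$, and $$S(\mathcal J_{g\cdot\phi},\mathcal J_{g\cdot\psi};F^*\mathrm{vol})\,F^*\mathrm{vol}=F^*\big(S(\mathcal J_\phi,\mathcal J_\psi;\mathrm{vol})\,\mathrm{vol}\big).$$ -/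

import Mathlib

open scoped TensorProduct ContDiff Manifold

noncomputable section

namespace GenKahler

/-! ## Linear algebra on one real vector space `V` (later: a tangent space) -/

section Linear

variable (V W : Type*) [AddCommGroup V] [Module ℝ V] [AddCommGroup W] [Module ℝ W]

/-- Real forms of mixed degree on `V`: the exterior algebra of the dual of `V`. -/
abbrev RForm := ExteriorAlgebra ℝ (Module.Dual ℝ V)

/-- Complex forms of mixed degree on `V`, i.e. `⋀ V^* ⊗ ℂ`, the spin representation. -/
abbrev CForm := ℂ ⊗[ℝ] RForm V

/-- The generalized tangent space `V ⊕ V^*`; an element `X + ξ` is stored as `(ξ, X)`. -/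
abbrev GT := Module.Dual ℝ V × V

/-- The complexification `(V ⊕ V^*)^ℂ`. -/
abbrev GTC := ℂ ⊗[ℝ] GT V

/-- Complex conjugation on the complexification `ℂ ⊗ W` of a real vector space `W`. -/
def conjC : (ℂ ⊗[ℝ] W) →ₗ[ℝ] (ℂ ⊗[ℝ] W) :=
  LinearMap.rTensor W Complex.conjAe.toLinearMap

/-- The real part `ℂ ⊗ W → W`. -/
def reC : (ℂ ⊗[ℝ] W) →ₗ[ℝ] W :=
  (TensorProduct.lid ℝ W).toLinearMap ∘ₗ LinearMap.rTensor W Complex.reLm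

variable {V W}

/-- A real form regarded as a complex form. -/
def ofR (α : RForm V) : CForm V := (1 : ℂ) ⊗ₜ[ℝ] α

/-- Pullback of real forms under a linear map. -/
def pullR (A : V →ₗ[ℝ] W) : RForm W →ₐ[ℝ] RForm V := ExteriorAlgebra.map A.dualMap

/-- Pullback of complex forms under a linear map. -/
def pullC (A : V →ₗ[ℝ] W) : CForm W →ₗ[ℂ] CForm V :=
  LinearMap.baseChange ℂ (pullR A).toLinearMap

/-- The symmetric pairing `⟨X + ξ, Y + η⟩ = (ξ(Y) + η(X)) / 2`. -/
def pairing : LinearMap.BilinForm ℝ (GT V) := (1 / 2 : ℝ) • LinearMap.dualProd ℝ V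

/-- The complex bilinear extension of the pairing. -/
def pairingC : LinearMap.BilinForm ℂ (GTC V) := LinearMap.BilinForm.baseChange ℂ (pairing (V := V))

/-- The action of `X + ξ` on real forms, `α ↦ i_X α + ξ ∧ α`. -/
def actR : GT V →ₗ[ℝ] Module.End ℝ (RForm V) where
  toFun e := CliffordAlgebra.contractLeft (Module.Dual.eval ℝ V e.2) +
    LinearMap.mulLeft ℝ (ExteriorAlgebra.ι ℝ e.1)
  map_add' e f := by
    refine LinearMap.ext fun α => ?_
    simp only [Prod.snd_add, Prod.fst_add, map_add, LinearMap.add_apply, LinearMap.mulLeft_apply,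
      add_mul]
    abel
  map_smul' c e := by
    refine LinearMap.ext fun α => ?_
    simp [smul_add]

/-- The square of `X + ξ` acts by `⟨X + ξ, X + ξ⟩ = ξ(X)`. -/
theorem actR_sq (e : GT V) :
    actR e * actR e = algebraMap ℝ (Module.End ℝ (RForm V)) (QuadraticForm.dualProd ℝ V e) := by
  refine LinearMap.ext fun α => ?_
  have h1 : CliffordAlgebra.contractLeft (Module.Dual.eval ℝ V e.2)
      (CliffordAlgebra.contractLeft (Module.Dual.eval ℝ V e.2) α) = 0 :=
    CliffordAlgebra.contractLeft_contractLeft _ _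
  have h2 : CliffordAlgebra.contractLeft (Module.Dual.eval ℝ V e.2)
      (ExteriorAlgebra.ι ℝ e.1 * α) = (e.1 e.2) • α - ExteriorAlgebra.ι ℝ e.1 *
        (CliffordAlgebra.contractLeft (Module.Dual.eval ℝ V e.2) α) :=
    CliffordAlgebra.contractLeft_ι_mul _ _ _
  have h3 : ExteriorAlgebra.ι ℝ e.1 * (ExteriorAlgebra.ι ℝ e.1 * α) = 0 := by
    rw [← mul_assoc, ExteriorAlgebra.ι_sq_zero, zero_mul]
  simp only [actR, LinearMap.coe_mk, AddHom.coe_mk, Module.End.mul_apply, LinearMap.add_apply,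
    LinearMap.mulLeft_apply, mul_add, h1, h2, h3, Module.algebraMap_end_apply,
    QuadraticForm.dualProd_apply]
  abel

/-- The spin representation of the real Clifford algebra of `V ⊕ V^*` on real forms. -/
def spinR : CliffordAlgebra (QuadraticForm.dualProd ℝ V) →ₐ[ℝ] Module.End ℝ (RForm V) :=
  CliffordAlgebra.lift _ ⟨actR, actR_sq⟩

/-- The action of a real Clifford element on complex forms. -/
def spinC (N : CliffordAlgebra (QuadraticForm.dualProd ℝ V)) : CForm V →ₗ[ℂ] CForm V :=
  LinearMap.baseChange ℂ (spinR N)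

/-- The action `e · Φ` of `e ∈ (V ⊕ V^*)^ℂ` on a complex form `Φ`. -/
def act : GTC V →ₗ[ℂ] CForm V →ₗ[ℂ] CForm V :=
  LinearMap.liftBaseChange ℂ ((LinearMap.baseChangeHom ℝ ℂ (RForm V) (RForm V)) ∘ₗ actR)

/-- The involution `σ`: it is `+1` in degrees `0, 1` and `-1` in degrees `2, 3` modulo `4`. -/
def sigma : CForm V →ₗ[ℂ] CForm V :=
  LinearMap.baseChange ℂ (CliffordAlgebra.reverse (Q := (0 : QuadraticForm ℝ (Module.Dual ℝ V))))

/-- The component of degree `k`. -/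
def comp (k : ℕ) : CForm V →ₗ[ℂ] CForm V :=
  LinearMap.baseChange ℂ (GradedAlgebra.proj (fun i : ℕ ↦ ⋀[ℝ]^i (Module.Dual ℝ V)) k)

/-- The pairing `⟨α, β⟩_s = (α ∧ σ β)_{[m]}` of spinors, with `m = dim V`. -/
def spinPairing (α β : CForm V) : CForm V := comp (Module.finrank ℝ V) (α * sigma β)

/-- `ker Φ = {e ∈ (V ⊕ V^*)^ℂ | e · Φ = 0}`. -/
def spinorKer (Φ : CForm V) : Submodule ℂ (GTC V) := LinearMap.ker (act.flip Φ)

/-- The degree involution, `(-1)^k` in degree `k`. -/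
def parity : CForm V →ₗ[ℂ] CForm V :=
  LinearMap.baseChange ℂ
    (CliffordAlgebra.involute (Q := (0 : QuadraticForm ℝ (Module.Dual ℝ V)))).toLinearMap

/-- Pure spinors: nonzero forms of even or odd type whose kernel, which is isotropic, has the
maximal dimension `dim V`. -/
structure IsPure (Φ : CForm V) : Prop where
  ne_zero : Φ ≠ 0
  even_or_odd : parity Φ = Φ ∨ parity Φ = -Φ
  finrank_ker : Module.finrank ℂ (spinorKer Φ) = Module.finrank ℝ V

/-- `ker Φ` meets its complex conjugate only in `0`. -/
def IsNondegenerate (Φ : CForm V) : Prop :=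
  ∀ e ∈ spinorKer Φ, conjC (GT V) e ∈ spinorKer Φ → e = 0

/-- `J = J_Φ`: `J` is `-√-1` on `ker Φ` and `√-1` on its conjugate. For a nondegenerate pure
spinor this determines the real endomorphism `J`. -/
def Induces (Φ : CForm V) (J : GT V →ₗ[ℝ] GT V) : Prop :=
  ∀ e ∈ spinorKer Φ, LinearMap.baseChange ℂ J e = -(Complex.I • e) ∧
    LinearMap.baseChange ℂ J (conjC (GT V) e) = Complex.I • conjC (GT V) e

/-- An almost generalized complex structure on `V`. -/
structure IsAlmostGC (J : GT V →ₗ[ℝ] GT V) : Prop where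
  sq : ∀ e, J (J e) = -e
  orth : ∀ e f, pairing (J e) (J f) = pairing e f

/-- An almost generalized Kähler structure on `V`: two commuting almost generalized complex
structures such that `⟨-J₁ J₂ e, e⟩` is positive definite. -/
structure IsAlmostGK (J₁ J₂ : GT V →ₗ[ℝ] GT V) : Prop where
  left : IsAlmostGC J₁
  right : IsAlmostGC J₂
  comm : ∀ e, J₁ (J₂ e) = J₂ (J₁ e)
  pos : ∀ e, e ≠ 0 → 0 < pairing (-(J₁ (J₂ e))) e

/-- The real elements of `⋀³ L ⊕ ⋀³ L̄`, where `L = {v + √-1 J v}` is the `-√-1`-eigenspace of `J`.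
They are spanned by the real parts of the products `l₁ l₂ l₃`, `lⱼ = vⱼ + √-1 J vⱼ`. Since `L` is
isotropic, such a product in the Clifford algebra is the exterior product. -/
def nijenhuisSpace (J : GT V →ₗ[ℝ] GT V) :
    Submodule ℝ (CliffordAlgebra (QuadraticForm.dualProd ℝ V)) :=
  let c := CliffordAlgebra.ι (QuadraticForm.dualProd ℝ V)
  Submodule.span ℝ {N | ∃ u v w : GT V, N = c u * c v * c w - c u * c (J v) * c (J w) -
    c (J u) * c v * c (J w) - c (J u) * c (J v) * c w}

/-- Transport of `X + ξ` from `W ⊕ W^*` to `V ⊕ V^*` along `A : V → W` with inverse `B`. -/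
def gtPull (A : V →ₗ[ℝ] W) (B : W →ₗ[ℝ] V) : GT W →ₗ[ℝ] GT V := A.dualMap.prodMap B

instance exteriorAlgebra_finite (U : Type*) [AddCommGroup U] [Module ℝ U] [FiniteDimensional ℝ U] :
    Module.Finite ℝ (ExteriorAlgebra ℝ U) := by
  have key : (⊤ : Submodule ℝ (ExteriorAlgebra ℝ U)) =
      ⨆ i ∈ Finset.range (Module.finrank ℝ U + 1), ⋀[ℝ]^i U := by
    symm
    rw [eq_top_iff, ← (DirectSum.Decomposition.isInternal
      (fun i : ℕ ↦ ⋀[ℝ]^i U)).submodule_iSup_eq_top]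
    refine iSup_le fun i => ?_
    by_cases hi : i ∈ Finset.range (Module.finrank ℝ U + 1)
    · exact le_iSup₂_of_le i hi le_rfl
    · have h0 : Module.finrank ℝ (⋀[ℝ]^i U) = 0 := by
        rw [exteriorPower.finrank_eq]
        exact Nat.choose_eq_zero_of_lt (by simpa using hi)
      rw [Submodule.finrank_eq_zero.mp h0]
      exact bot_le
  rw [Module.finite_def, key]
  refine Submodule.fg_biSup _ _ fun i _ => ?_
  exact Module.Finite.iff_fg.mp inferInstance

end Linear

/-! ## Calculus on the model space -/

section Calculus

variable {E : Type*} [NormedAddCommGroup E] [NormedSpace ℝ E]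
variable {W : Type*} [AddCommGroup W] [Module ℝ W]

/-- Smoothness on `s` of a function with values in a finite-dimensional real vector space: all
linear coordinates are smooth. -/
def SmoothOn (f : E → W) (s : Set E) : Prop :=
  ∀ l : W →ₗ[ℝ] ℝ, ContDiffOn ℝ ∞ (fun y => l (f y)) s

/-- The derivative of `f` at `y` in the direction `v`, taken coordinatewise (it does not depend on
the basis). -/
def dirDeriv [Module.Finite ℝ W] (f : E → W) (y v : E) : W :=
  ∑ i, (fderiv ℝ (fun z => (Module.finBasis ℝ W).repr (f z) i) y v) • Module.finBasis ℝ W i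

/-- The exterior derivative `∑ dxᵢ ∧ ∂ᵢ τ` on `ℝ^m`. -/
def extD {m : ℕ} (τ : EuclideanSpace ℝ (Fin m) → CForm (EuclideanSpace ℝ (Fin m)))
    (y : EuclideanSpace ℝ (Fin m)) : CForm (EuclideanSpace ℝ (Fin m)) :=
  ∑ i : Fin m, ofR (ExteriorAlgebra.ι ℝ
      ((EuclideanSpace.proj i : EuclideanSpace ℝ (Fin m) →L[ℝ] ℝ).toLinearMap)) *
    dirDeriv τ y (EuclideanSpace.single i 1)

end Calculus

/-! ## Manifolds -/

section Manifold

variable {n : ℕ} {M : Type*} [TopologicalSpace M] [ChartedSpace (EuclideanSpace ℝ (Fin (2 * n))) M]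

/-- The tangent space of the `2n`-dimensional manifold `M` at `x`. -/
abbrev T (n : ℕ) {M : Type*} [TopologicalSpace M]
    [ChartedSpace (EuclideanSpace ℝ (Fin (2 * n))) M] (x : M) := TangentSpace (𝓡 (2 * n)) x

variable (n M)

/-- Fields of real forms. -/
abbrev RField := ∀ x : M, RForm (T n x)

/-- Fields of complex forms. -/
abbrev CField := ∀ x : M, CForm (T n x)

/-- Sections of `(T ⊕ T^*)^ℂ`. -/
abbrev GTField := ∀ x : M, GTC (T n x)

/-- Fields of endomorphisms of `T ⊕ T^*`. -/
abbrev JField := ∀ x : M, GT (T n x) →ₗ[ℝ] GT (T n x)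

variable {n M}

/-- The derivative at `x` of the chart around `p`. -/
def dChart (n : ℕ) {M : Type*} [TopologicalSpace M]
    [ChartedSpace (EuclideanSpace ℝ (Fin (2 * n))) M] (p x : M) :
    T n x →ₗ[ℝ] EuclideanSpace ℝ (Fin (2 * n)) :=
  (mfderiv (𝓡 (2 * n)) 𝓘(ℝ, EuclideanSpace ℝ (Fin (2 * n))) (extChartAt (𝓡 (2 * n)) p)
    x).toLinearMap

/-- The derivative at `y` of the inverse of the chart around `p`. -/
def dChartInv {M : Type*} [TopologicalSpace M]
    [ChartedSpace (EuclideanSpace ℝ (Fin (2 * n))) M] (p : M) (y : EuclideanSpace ℝ (Fin (2 * n))) :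
    EuclideanSpace ℝ (Fin (2 * n)) →ₗ[ℝ] T n ((extChartAt (𝓡 (2 * n)) p).symm y) :=
  (mfderiv 𝓘(ℝ, EuclideanSpace ℝ (Fin (2 * n))) (𝓡 (2 * n)) (extChartAt (𝓡 (2 * n)) p).symm
    y).toLinearMap

/-- A field of complex forms, written in the chart around `p`. -/
def inChart (τ : CField n M) (p : M) (y : EuclideanSpace ℝ (Fin (2 * n))) :
    CForm (EuclideanSpace ℝ (Fin (2 * n))) :=
  pullC (dChartInv p y) (τ ((extChartAt (𝓡 (2 * n)) p).symm y))

/-- A section of `(T ⊕ T^*)^ℂ`, written in the chart around `p`. -/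
def gtInChart (e : GTField n M) (p : M) (y : EuclideanSpace ℝ (Fin (2 * n))) :
    GTC (EuclideanSpace ℝ (Fin (2 * n))) :=
  LinearMap.baseChange ℂ (gtPull (dChartInv p y)
    (dChart n p ((extChartAt (𝓡 (2 * n)) p).symm y))) (e ((extChartAt (𝓡 (2 * n)) p).symm y))

/-- The part of the chart around `p` that corresponds to `U`. -/
def chartDomain (n : ℕ) {M : Type*} [TopologicalSpace M]
    [ChartedSpace (EuclideanSpace ℝ (Fin (2 * n))) M] (p : M) (U : Set M) :
    Set (EuclideanSpace ℝ (Fin (2 * n))) :=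
  (extChartAt (𝓡 (2 * n)) p).target ∩ (extChartAt (𝓡 (2 * n)) p).symm ⁻¹' U

/-- Smoothness of a field of complex forms on an open set `U`. -/
def FormSmoothOn (U : Set M) (τ : CField n M) : Prop :=
  ∀ p : M, SmoothOn (inChart τ p) (chartDomain n p U)

/-- Smoothness of a section of `(T ⊕ T^*)^ℂ` on an open set `U`. -/
def GTSmoothOn (U : Set M) (e : GTField n M) : Prop :=
  ∀ p : M, SmoothOn (gtInChart e p) (chartDomain n p U)

/-- Smooth real differential forms of degree `k` on `M`. -/
structure IsRealForm (k : ℕ) (α : RField n M) : Prop where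
  degree : ∀ x, α x ∈ ⋀[ℝ]^k (Module.Dual ℝ (T n x))
  smooth : FormSmoothOn Set.univ (fun x => ofR (α x))

/-- The exterior derivative on `M`, computed at `x` in the chart around `x`. -/
def d (τ : CField n M) : CField n M := fun x =>
  pullC (dChart n x x) (extD (inChart τ x) (extChartAt (𝓡 (2 * n)) x x))

/-- The twisted differential `d_H = d + H ∧`. -/
def dTw (H : RField n M) (τ : CField n M) : CField n M := fun x => d τ x + ofR (H x) * τ x

/-- The pointwise action of a section of `(T ⊕ T^*)^ℂ` on a field of forms. -/
def actF (e : GTField n M) (τ : CField n M) : CField n M := fun x => act (e x) (τ x)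

/-- The `H`-twisted Lie derivative `L^H_e = d_H e + e d_H`. -/
def lieTw (H : RField n M) (e : GTField n M) (τ : CField n M) : CField n M := fun x =>
  dTw H (actF e τ) x + act (e x) (dTw H τ x)

/-- The complex conjugate field of forms. -/
def conjF (τ : CField n M) : CField n M := fun x => conjC _ (τ x)

/-- Closed real `3`-forms. -/
structure IsClosedThreeForm (H : RField n M) : Prop extends IsRealForm 3 H where
  closed : d (fun x => ofR (H x)) = 0

/-- Volume forms: nowhere vanishing smooth real forms of top degree. -/
structure IsVolumeForm (vol : RField n M) : Prop extends IsRealForm (2 * n) vol where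
  ne_zero : ∀ x, vol x ≠ 0

/-- `φ` is, on the open set `U`, a smooth local trivialization of the canonical line bundle of `J`
by nondegenerate pure spinors, normalized by `i⁻ⁿ ⟨φ, φ̄⟩_s = vol`. -/
structure IsTrivialization (U : Set M) (φ : CField n M) (J : JField n M) (vol : RField n M) :
    Prop where
  smooth : FormSmoothOn U φ
  pure : ∀ x ∈ U, IsPure (φ x)
  nondegenerate : ∀ x ∈ U, IsNondegenerate (φ x)
  induces : ∀ x ∈ U, Induces (φ x) (J x)
  normalized : ∀ x ∈ U,
    (Complex.I ^ n)⁻¹ • spinPairing (φ x) (conjC _ (φ x)) = ofR (vol x)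

/-- On `U`, `η` is a smooth purely imaginary section of `(T ⊕ T^*)^ℂ` with
`d_H φ = (η + N) · φ` for a real `3`-tensor `N`, the Nijenhuis tensor, of type `(3,0) + (0,3)` with
respect to `J`. -/
structure IsConnectionTerm (H : RField n M) (U : Set M) (φ : CField n M) (J : JField n M)
    (η : GTField n M) : Prop where
  smooth : GTSmoothOn U η
  imaginary : ∀ x ∈ U, conjC _ (η x) = -η x
  eq : ∀ x ∈ U, ∃ N ∈ nijenhuisSpace (J x), dTw H φ x = act (η x) (φ x) + spinC N (φ x)

/-- The real top form
`Re (i⁻ⁿ ⟨ψ, L^H_η ψ̄⟩_s + i⁻ⁿ ⟨φ, L^H_ζ φ̄⟩_s) + 2 ⟨ζ, η⟩ vol`. The number `⟨ζ, η⟩` is real when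
`ζ` and `η` are purely imaginary. -/
def curvatureForm (H : RField n M) (vol : RField n M) (φ ψ : CField n M) (η ζ : GTField n M) :
    RField n M := fun x =>
  reC _ ((Complex.I ^ n)⁻¹ • spinPairing (ψ x) (lieTw H η (conjF ψ) x) +
    (Complex.I ^ n)⁻¹ • spinPairing (φ x) (lieTw H ζ (conjF φ) x)) +
  (2 * (pairingC (ζ x) (η x)).re) • vol x

/-- `s` is the value at `x` of the scalar curvature of `(J₁, J₂)` with respect to `vol`, computed
from some normalized local trivializations near `x`. -/
def IsScalarCurvatureAt (H : RField n M) (J₁ J₂ : JField n M) (vol : RField n M) (x : M) (s : ℝ) :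
    Prop :=
  ∃ (U : Set M) (φ ψ : CField n M) (η ζ : GTField n M), IsOpen U ∧ x ∈ U ∧
    IsTrivialization U φ J₁ vol ∧ IsTrivialization U ψ J₂ vol ∧
    IsConnectionTerm H U φ J₁ η ∧ IsConnectionTerm H U ψ J₂ ζ ∧
    s • vol x = curvatureForm H vol φ ψ η ζ x

/-- The scalar curvature `S(J₁, J₂)` with respect to the volume form `vol`: its value at `x` is the
number computed from normalized local trivializations near `x`, which does not depend on them. -/
def scalarCurvature (H : RField n M) (J₁ J₂ : JField n M) (vol : RField n M) (x : M) : ℝ :=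
  Classical.epsilon (IsScalarCurvatureAt H J₁ J₂ vol x)

/-! ## Diffeomorphisms extended by `b`-fields -/

/-- Pullback of real forms under a diffeomorphism. -/
def pullback (F : M ≃ₘ⟮𝓡 (2 * n), 𝓡 (2 * n)⟯ M) (α : RField n M) : RField n M := fun x =>
  pullR (mfderiv (𝓡 (2 * n)) (𝓡 (2 * n)) F x).toLinearMap (α (F x))

/-- The identity component of the diffeomorphism group of a compact manifold: the diffeomorphisms
that are smoothly isotopic to the identity. -/
def IsInDiff₀ (F : M ≃ₘ⟮𝓡 (2 * n), 𝓡 (2 * n)⟯ M) : Prop :=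
  ∃ G : ℝ → M ≃ₘ⟮𝓡 (2 * n), 𝓡 (2 * n)⟯ M,
    ContMDiff (𝓘(ℝ, ℝ).prod (𝓡 (2 * n))) (𝓡 (2 * n)) ∞ (fun p : ℝ × M => G p.1 p.2) ∧
    G 0 = Diffeomorph.refl (𝓡 (2 * n)) M ∞ ∧ G 1 = F

variable (n M) in
/-- The elements `e^b F`, with `F` a diffeomorphism and `b` a real `2`-form. -/
structure ExtDiffeo where
  F : M ≃ₘ⟮𝓡 (2 * n), 𝓡 (2 * n)⟯ M
  b : RField n M
  isForm : IsRealForm 2 b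

/-- The action `g · τ = e^b ∧ F^* τ` of `g = e^b F` on forms. If `τ` is given on `U`, then `g · τ` is
given on `F⁻¹(U)`. -/
def ExtDiffeo.smul (g : ExtDiffeo n M) (τ : CField n M) : CField n M := fun x =>
  ofR (IsNilpotent.exp (g.b x)) *
    pullC (mfderiv (𝓡 (2 * n)) (𝓡 (2 * n)) g.F x).toLinearMap (τ (g.F x))

/-- The group of the `g = e^b F` with `F` in the identity component of the diffeomorphism group
such that `g` commutes with `d_H` on differential forms (that is, `db = F^* H - H`). -/
def extDiff₀ (H : RField n M) : Set (ExtDiffeo n M) :=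
  {g | IsInDiff₀ g.F ∧
    ∀ τ : CField n M, FormSmoothOn Set.univ τ → dTw H (g.smul τ) = g.smul (dTw H τ)}

end Manifold

end GenKahler

end

/-!
Pointwise, `e^b F` is an isomorphism of vector spaces followed by a `B`-field transform. Such
extended isomorphisms form a groupoid, which acts compatibly on spinors, on `T ⊕ T*`, on its
endomorphisms and on its Clifford algebra, and preserves the Mukai pairing because
`σ (e^b τ) = e^{-b} σ τ`. Since `d_H` is a local operator, bump functions show that if `e^b F`
commutes with `d_H` on global forms then it does so on locally defined spinors. Hence it carries
normalized trivializations near `F x`, with their connection terms, to normalized trivializations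
near `x`, and every value admissible as the scalar curvature at `F x` is admissible at `x`. The
inverse of `e^b F` gives the converse, so both curvatures are chosen from the same set of values.
-/

open scoped TensorProduct ContDiff Manifold

noncomputable section

namespace GenKahler

section CliffordMap

open CliffordAlgebra

variable {R M N : Type*} [CommRing R] [AddCommGroup M] [Module R M] [AddCommGroup N] [Module R N]
  {Q : QuadraticForm R M} {Q' : QuadraticForm R N}

theorem involute_map (f : Q →qᵢ Q') (a : CliffordAlgebra Q) :
    involute (map f a) = map f (involute a) := by
  have h : involute.comp (map f) = (map f).comp involute := by
    ext m
    simp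
  exact DFunLike.congr_fun h a

theorem reverse_map (f : Q →qᵢ Q') (a : CliffordAlgebra Q) :
    reverse (map f a) = map f (reverse a) := by
  have h : reverseOp.comp (map f) = (AlgHom.op (map f)).comp reverseOp := by
    ext m
    simp
  exact congrArg MulOpposite.unop (DFunLike.congr_fun h a)

theorem contractLeft_map (f : Q →qᵢ Q') (l : Module.Dual R N) (a : CliffordAlgebra Q) :
    contractLeft l (map f a) = map f (contractLeft (l ∘ₗ f.toLinearMap) a) := by
  induction a using left_induction with
  | algebraMap r => simp only [AlgHom.commutes, contractLeft_algebraMap, map_zero]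
  | add a b ha hb => simp only [map_add, ha, hb]
  | ι_mul a m ha =>
    simp only [map_mul, map_apply_ι, contractLeft_ι_mul, ha, map_sub, map_smul]
    rfl

end CliffordMap

section ExteriorMap

variable {R M N : Type*} [CommRing R] [AddCommGroup M] [Module R M] [AddCommGroup N] [Module R N]

theorem map_mem_exteriorPower (f : M →ₗ[R] N) {k : ℕ} {α : ExteriorAlgebra R M}
    (hα : α ∈ ⋀[R]^k M) : ExteriorAlgebra.map f α ∈ ⋀[R]^k N := by
  have hle : (⋀[R]^k M).map (ExteriorAlgebra.map f).toLinearMap ≤ ⋀[R]^k N := by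
    rw [ExteriorAlgebra.exteriorPower, ExteriorAlgebra.exteriorPower, Submodule.map_pow]
    refine pow_le_pow_left' ?_ k
    rintro _ ⟨_, ⟨u, rfl⟩, rfl⟩
    exact ⟨f u, (ExteriorAlgebra.map_apply_ι _ _).symm⟩
  exact hle (Submodule.mem_map_of_mem hα)

theorem proj_map (f : M →ₗ[R] N) (k : ℕ) (α : ExteriorAlgebra R M) :
    GradedAlgebra.proj (fun i : ℕ ↦ ⋀[R]^i N) k (ExteriorAlgebra.map f α) =
      ExteriorAlgebra.map f (GradedAlgebra.proj (fun i : ℕ ↦ ⋀[R]^i M) k α) := by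
  induction α using DirectSum.Decomposition.inductionOn (fun i : ℕ ↦ ⋀[R]^i M) with
  | zero => simp only [map_zero]
  | add α β hα hβ => simp only [map_add, hα, hβ]
  | @homogeneous i α =>
    have hα := map_mem_exteriorPower f α.2
    rw [GradedAlgebra.proj_apply, GradedAlgebra.proj_apply]
    obtain rfl | h := eq_or_ne i k
    · rw [DirectSum.decompose_of_mem_same (fun i : ℕ ↦ ⋀[R]^i N) hα,
        DirectSum.decompose_of_mem_same (fun i : ℕ ↦ ⋀[R]^i M) α.2]
    · rw [DirectSum.decompose_of_mem_ne (fun i : ℕ ↦ ⋀[R]^i N) hα h,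
        DirectSum.decompose_of_mem_ne (fun i : ℕ ↦ ⋀[R]^i M) α.2 h, map_zero]

end ExteriorMap

section TwoForm

variable {R M : Type*} [CommRing R] [AddCommGroup M] [Module R M] {b : ExteriorAlgebra R M}

@[elab_as_elim]
theorem exteriorPower_two_induction {P : ExteriorAlgebra R M → Prop} (hb : b ∈ ⋀[R]^2 M)
    (hι : ∀ u v : M, P (ExteriorAlgebra.ι R u * ExteriorAlgebra.ι R v))
    (hadd : ∀ x y, P x → P y → P (x + y)) : P b := by
  rw [ExteriorAlgebra.exteriorPower, pow_two] at hb
  refine Submodule.mul_induction_on hb ?_ hadd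
  rintro _ ⟨u, rfl⟩ _ ⟨v, rfl⟩
  exact hι u v

theorem ι_mul_ι_comm (u v : M) :
    ExteriorAlgebra.ι R u * ExteriorAlgebra.ι R v =
      -(ExteriorAlgebra.ι R v * ExteriorAlgebra.ι R u) :=
  eq_neg_of_add_eq_zero_left (ExteriorAlgebra.ι_add_mul_swap u v)

theorem commute_of_mem_exteriorPower_two (hb : b ∈ ⋀[R]^2 M) (α : ExteriorAlgebra R M) :
    Commute b α := by
  refine exteriorPower_two_induction hb (fun u v => ?_) fun _ _ => Commute.add_left
  induction α using ExteriorAlgebra.induction with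
  | algebraMap r => exact (Algebra.commutes r _).symm
  | ι w =>
    rw [commute_iff_eq, mul_assoc, ι_mul_ι_comm v w, mul_neg, ← mul_assoc, ι_mul_ι_comm u w,
      neg_mul, neg_neg, mul_assoc]
  | mul α β hα hβ => exact hα.mul_right hβ
  | add α β hα hβ => exact hα.add_right hβ

theorem isNilpotent_of_mem_exteriorPower_two (hb : b ∈ ⋀[R]^2 M) : IsNilpotent b := by
  suffices h : b ∈ ⋀[R]^2 M ∧ IsNilpotent b from h.2
  refine exteriorPower_two_induction hb (fun u v => ?_) fun x y hx hy =>
    ⟨add_mem hx.1 hy.1, (commute_of_mem_exteriorPower_two hx.1 y).isNilpotent_add hx.2 hy.2⟩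
  have huv : ExteriorAlgebra.ι R u * ExteriorAlgebra.ι R v ∈ ⋀[R]^2 M := by
    rw [ExteriorAlgebra.exteriorPower, pow_two]
    exact Submodule.mul_mem_mul ⟨u, rfl⟩ ⟨v, rfl⟩
  refine ⟨huv, 2, ?_⟩
  rw [pow_two, mul_assoc, ← (commute_of_mem_exteriorPower_two huv _).eq, mul_assoc,
    ExteriorAlgebra.ι_sq_zero, mul_zero, mul_zero]

theorem pow_finrank_add_one_of_mem_exteriorPower_two {K V : Type*} [Field K] [AddCommGroup V]
    [Module K V] [FiniteDimensional K V] {b : ExteriorAlgebra K V} (hb : b ∈ ⋀[K]^2 V) :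
    b ^ (Module.finrank K V + 1) = 0 := by
  set N := Module.finrank K V + 1
  have hpow : b ^ N ∈ ⋀[K]^(2 * N) V := by
    rw [ExteriorAlgebra.exteriorPower, pow_mul]
    exact Submodule.pow_mem_pow _ hb N
  have hfinrank : Module.finrank K (⋀[K]^(2 * N) V) = 0 := by
    rw [exteriorPower.finrank_eq]
    exact Nat.choose_eq_zero_of_lt (by omega)
  rwa [Submodule.finrank_eq_zero.mp hfinrank, Submodule.mem_bot] at hpow

theorem involute_of_mem_exteriorPower_two (hb : b ∈ ⋀[R]^2 M) :
    CliffordAlgebra.involute b = b := by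
  refine exteriorPower_two_induction hb (fun u v => ?_) fun x y hx hy => by rw [map_add, hx, hy]
  simp only [ExteriorAlgebra.ι, map_mul, CliffordAlgebra.involute_ι, neg_mul_neg]

theorem reverse_of_mem_exteriorPower_two (hb : b ∈ ⋀[R]^2 M) :
    CliffordAlgebra.reverse b = -b := by
  refine exteriorPower_two_induction hb (fun u v => ?_) fun x y hx hy => by
    rw [map_add, hx, hy, neg_add]
  rw [← ι_mul_ι_comm]
  simp only [ExteriorAlgebra.ι, CliffordAlgebra.reverse.map_mul, CliffordAlgebra.reverse_ι]

theorem exists_ι_eq_contractLeft (hb : b ∈ ⋀[R]^2 M) (l : Module.Dual R M) :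
    ∃ u, ExteriorAlgebra.ι R u = CliffordAlgebra.contractLeft l b := by
  refine exteriorPower_two_induction hb (fun u v => ⟨l u • v - l v • u, ?_⟩) ?_
  · simp only [ExteriorAlgebra.ι, CliffordAlgebra.contractLeft_ι_mul,
      CliffordAlgebra.contractLeft_ι, map_sub, map_smul, ← Algebra.commutes, ← Algebra.smul_def]
  · rintro x y ⟨u, hu⟩ ⟨v, hv⟩
    exact ⟨u + v, by rw [map_add, map_add, hu, hv]⟩

theorem contractLeft_mul_of_mem_exteriorPower_two (hb : b ∈ ⋀[R]^2 M) (l : Module.Dual R M)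
    (α : ExteriorAlgebra R M) :
    CliffordAlgebra.contractLeft l (b * α) =
      CliffordAlgebra.contractLeft l b * α + b * CliffordAlgebra.contractLeft l α := by
  refine exteriorPower_two_induction hb (fun u v => ?_) fun x y hx hy => ?_
  · simp only [ExteriorAlgebra.ι, mul_assoc, CliffordAlgebra.contractLeft_ι_mul,
      CliffordAlgebra.contractLeft_ι, mul_sub, sub_mul, mul_smul_comm, smul_mul_assoc,
      ← Algebra.smul_def]
    abel
  · rw [add_mul, map_add, hx, hy, map_add, add_mul, add_mul]
    abel

theorem contractLeft_pow_mul_of_mem_exteriorPower_two (hb : b ∈ ⋀[R]^2 M) (l : Module.Dual R M)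
    (k : ℕ) (α : ExteriorAlgebra R M) :
    CliffordAlgebra.contractLeft l (b ^ (k + 1) * α) =
      (k + 1) • (CliffordAlgebra.contractLeft l b * (b ^ k * α)) +
        b ^ (k + 1) * CliffordAlgebra.contractLeft l α := by
  induction k generalizing α with
  | zero => simpa using contractLeft_mul_of_mem_exteriorPower_two hb l α
  | succ k ih =>
    set β := CliffordAlgebra.contractLeft l b
    have hcomm : b ^ (k + 1) * (β * α) = β * (b ^ (k + 1) * α) :=
      ((commute_of_mem_exteriorPower_two hb β).pow_left (k + 1)).left_comm α
    rw [pow_succ b (k + 1), mul_assoc, ih, contractLeft_mul_of_mem_exteriorPower_two hb, mul_add,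
      hcomm, ← mul_assoc (b ^ k), ← pow_succ, succ_nsmul _ (k + 1), mul_assoc]
    abel

end TwoForm

section ExpTwoForm

variable {R M N : Type*} [CommRing R] [AddCommGroup M] [Module R M] [AddCommGroup N] [Module R N]
  [Module ℚ (ExteriorAlgebra R M)] {b c : ExteriorAlgebra R M}

theorem exp_commute_of_mem_exteriorPower_two (hb : b ∈ ⋀[R]^2 M) (α : ExteriorAlgebra R M) :
    Commute (IsNilpotent.exp b) α := by
  rw [IsNilpotent.exp]
  exact Commute.sum_left _ _ _ fun i _ =>
    ((commute_of_mem_exteriorPower_two hb α).pow_left i).smul_left _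

theorem exp_add_of_mem_exteriorPower_two (hb : b ∈ ⋀[R]^2 M) (hc : c ∈ ⋀[R]^2 M) :
    IsNilpotent.exp (b + c) = IsNilpotent.exp b * IsNilpotent.exp c :=
  IsNilpotent.exp_add_of_commute (commute_of_mem_exteriorPower_two hb c)
    (isNilpotent_of_mem_exteriorPower_two hb) (isNilpotent_of_mem_exteriorPower_two hc)

theorem map_exp_of_mem_exteriorPower_two [Module ℚ (ExteriorAlgebra R N)] (f : M →ₗ[R] N)
    (hb : b ∈ ⋀[R]^2 M) :
    ExteriorAlgebra.map f (IsNilpotent.exp b) = IsNilpotent.exp (ExteriorAlgebra.map f b) :=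
  IsNilpotent.map_exp (isNilpotent_of_mem_exteriorPower_two hb) _

theorem involute_exp_of_mem_exteriorPower_two (hb : b ∈ ⋀[R]^2 M) :
    CliffordAlgebra.involute (IsNilpotent.exp b) = IsNilpotent.exp b := by
  rw [IsNilpotent.map_exp (isNilpotent_of_mem_exteriorPower_two hb) CliffordAlgebra.involute,
    involute_of_mem_exteriorPower_two hb]

theorem reverse_exp_of_mem_exteriorPower_two (hb : b ∈ ⋀[R]^2 M) :
    CliffordAlgebra.reverse (IsNilpotent.exp b) = IsNilpotent.exp (-b) := by
  have hpow (i : ℕ) : CliffordAlgebra.reverse (b ^ i) = (-b) ^ i := by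
    induction i with
    | zero => simp only [pow_zero, CliffordAlgebra.reverse.map_one]
    | succ i ih =>
      rw [pow_succ, CliffordAlgebra.reverse.map_mul, ih, reverse_of_mem_exteriorPower_two hb,
        ← pow_succ']
  obtain ⟨k, hk⟩ := isNilpotent_of_mem_exteriorPower_two hb
  have hk' : (-b) ^ k = 0 := by rw [neg_pow, hk, mul_zero]
  rw [IsNilpotent.exp_eq_sum hk, IsNilpotent.exp_eq_sum hk', map_sum]
  exact Finset.sum_congr rfl fun i _ => by rw [map_rat_smul, hpow]

theorem contractLeft_exp_mul_of_mem_exteriorPower_two (hb : b ∈ ⋀[R]^2 M) (l : Module.Dual R M)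
    (α : ExteriorAlgebra R M) :
    CliffordAlgebra.contractLeft l (IsNilpotent.exp b * α) =
      CliffordAlgebra.contractLeft l b * (IsNilpotent.exp b * α) +
        IsNilpotent.exp b * CliffordAlgebra.contractLeft l α := by
  obtain ⟨k, hk⟩ := isNilpotent_of_mem_exteriorPower_two hb
  have hk' : b ^ (k + 1) = 0 := by rw [pow_succ, hk, zero_mul]
  have hterm (i : ℕ) :
      CliffordAlgebra.contractLeft l ((((i + 1).factorial : ℚ)⁻¹ • b ^ (i + 1)) * α) =
        CliffordAlgebra.contractLeft l b * (((i.factorial : ℚ)⁻¹ • b ^ i) * α) +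
          (((i + 1).factorial : ℚ)⁻¹ • b ^ (i + 1)) * CliffordAlgebra.contractLeft l α := by
    rw [smul_mul_assoc, map_rat_smul, contractLeft_pow_mul_of_mem_exteriorPower_two hb, smul_add,
      smul_mul_assoc, smul_mul_assoc, mul_smul_comm, ← Nat.cast_smul_eq_nsmul ℚ, smul_smul,
      Nat.factorial_succ]
    congr 2
    push_cast
    field_simp
  calc CliffordAlgebra.contractLeft l (IsNilpotent.exp b * α)
      = CliffordAlgebra.contractLeft l b *
            ((∑ i ∈ Finset.range k, (i.factorial : ℚ)⁻¹ • b ^ i) * α) +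
          (∑ i ∈ Finset.range (k + 1), (i.factorial : ℚ)⁻¹ • b ^ i) *
            CliffordAlgebra.contractLeft l α := by
        rw [IsNilpotent.exp_eq_sum hk', Finset.sum_range_succ', add_mul, map_add, Finset.sum_mul,
          map_sum, Finset.sum_congr rfl fun i _ => hterm i, Finset.sum_add_distrib,
          ← Finset.mul_sum, ← Finset.sum_mul, ← Finset.sum_mul, add_mul]
        simp [add_assoc]
    _ = _ := by rw [← IsNilpotent.exp_eq_sum hk', ← IsNilpotent.exp_eq_sum hk]

end ExpTwoForm

section Complexification

variable {P Q S : Type*} [AddCommGroup P] [Module ℝ P] [AddCommGroup Q] [Module ℝ Q]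
  [AddCommGroup S] [Module ℝ S]

theorem conjC_baseChange (f : P →ₗ[ℝ] Q) (t : ℂ ⊗[ℝ] P) :
    conjC Q (f.baseChange ℂ t) = f.baseChange ℂ (conjC P t) := by
  induction t using TensorProduct.induction_on with
  | zero => simp only [map_zero]
  | tmul z p => rfl
  | add s t hs ht => simp only [map_add, hs, ht]

theorem reC_baseChange (f : P →ₗ[ℝ] Q) (t : ℂ ⊗[ℝ] P) :
    reC Q (f.baseChange ℂ t) = f (reC P t) := by
  induction t using TensorProduct.induction_on with
  | zero => simp only [map_zero]
  | tmul z p => simp [reC]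
  | add s t hs ht => simp only [map_add, hs, ht]

theorem baseChange_baseChange (g : Q →ₗ[ℝ] S) (f : P →ₗ[ℝ] Q) (t : ℂ ⊗[ℝ] P) :
    g.baseChange ℂ (f.baseChange ℂ t) = (g ∘ₗ f).baseChange ℂ t := by
  rw [LinearMap.baseChange_comp, LinearMap.comp_apply]

end Complexification

section Forms

variable {V W Z : Type*} [AddCommGroup V] [Module ℝ V] [AddCommGroup W] [Module ℝ W]
  [AddCommGroup Z] [Module ℝ Z]

theorem ofR_mul (α β : RForm V) : ofR (α * β) = ofR α * ofR β := by
  rw [ofR, ofR, ofR, Algebra.TensorProduct.tmul_mul_tmul, one_mul]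

theorem conjC_ofR_mul (α : RForm V) (τ : CForm V) :
    conjC _ (ofR α * τ) = ofR α * conjC _ τ := by
  induction τ using TensorProduct.induction_on with
  | zero => simp only [mul_zero, map_zero]
  | tmul z β =>
    rw [ofR, Algebra.TensorProduct.tmul_mul_tmul, one_mul, conjC, LinearMap.rTensor_tmul,
      LinearMap.rTensor_tmul, Algebra.TensorProduct.tmul_mul_tmul, one_mul]
  | add σ τ hσ hτ => simp only [mul_add, map_add, hσ, hτ]

theorem commute_ofR {α : RForm V} (hα : ∀ β, Commute α β) (τ : CForm V) :
    Commute (ofR α) τ := by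
  induction τ using TensorProduct.induction_on with
  | zero => exact Commute.zero_right _
  | tmul z β =>
    rw [commute_iff_eq, ofR, Algebra.TensorProduct.tmul_mul_tmul,
      Algebra.TensorProduct.tmul_mul_tmul, (hα β).eq, one_mul, mul_one]
  | add σ τ hσ hτ => exact hσ.add_right hτ

theorem pullR_comp (A : V →ₗ[ℝ] W) (B : W →ₗ[ℝ] Z) (α : RForm Z) :
    pullR A (pullR B α) = pullR (B ∘ₗ A) α := by
  have h : (pullR A).comp (pullR B) = pullR (B ∘ₗ A) := by
    rw [pullR, pullR, pullR, ExteriorAlgebra.map_comp_map, LinearMap.dualMap_comp_dualMap]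
  exact DFunLike.congr_fun h α

theorem pullR_id (α : RForm V) : pullR LinearMap.id α = α := by
  rw [pullR, LinearMap.dualMap_id, ExteriorAlgebra.map_id, AlgHom.id_apply]

theorem pullR_mem_exteriorPower (A : V →ₗ[ℝ] W) {k : ℕ} {α : RForm W}
    (hα : α ∈ ⋀[ℝ]^k (Module.Dual ℝ W)) : pullR A α ∈ ⋀[ℝ]^k (Module.Dual ℝ V) :=
  map_mem_exteriorPower _ hα

theorem pullC_comp (A : V →ₗ[ℝ] W) (B : W →ₗ[ℝ] Z) (τ : CForm Z) :
    pullC A (pullC B τ) = pullC (B ∘ₗ A) τ := by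
  rw [pullC, pullC, pullC, baseChange_baseChange]
  congr 2
  exact LinearMap.ext (pullR_comp A B)

theorem pullC_id (τ : CForm V) : pullC LinearMap.id τ = τ := by
  have h : (pullR (LinearMap.id : V →ₗ[ℝ] V)).toLinearMap = LinearMap.id :=
    LinearMap.ext pullR_id
  rw [pullC, h, LinearMap.baseChange_id, LinearMap.id_apply]

theorem pullC_ofR (A : V →ₗ[ℝ] W) (α : RForm W) : pullC A (ofR α) = ofR (pullR A α) := rfl

theorem pullC_mul (A : V →ₗ[ℝ] W) (σ τ : CForm W) : pullC A (σ * τ) = pullC A σ * pullC A τ :=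
  map_mul (Algebra.TensorProduct.map (AlgHom.id ℂ ℂ) (pullR A)) σ τ

theorem reC_pullC (A : V →ₗ[ℝ] W) (τ : CForm W) : reC _ (pullC A τ) = pullR A (reC _ τ) :=
  reC_baseChange _ τ

theorem pullR_reC_smul_add_smul_add_smul (A : V →ₗ[ℝ] W) (c : ℂ) (σ τ : CForm W) (r : ℝ)
    (α : RForm W) : pullR A (reC _ (c • σ + c • τ) + r • α) =
      reC _ (c • pullC A σ + c • pullC A τ) + r • pullR A α := by
  rw [← map_smul, ← map_smul, ← map_add, reC_pullC, map_add (pullR A), map_smul (pullR A)]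

theorem parity_mul (σ τ : CForm V) : parity (σ * τ) = parity σ * parity τ :=
  map_mul (Algebra.TensorProduct.map (AlgHom.id ℂ ℂ) CliffordAlgebra.involute) σ τ

theorem sigma_mul (σ τ : CForm V) : sigma (σ * τ) = sigma τ * sigma σ := by
  have h : (LinearMap.mul ℂ (CForm V)).compr₂ sigma =
      ((LinearMap.mul ℂ (CForm V)).compl₁₂ sigma sigma).flip := by
    ext α β
    simp [sigma, CliffordAlgebra.reverse.map_mul]
  exact LinearMap.congr_fun₂ h σ τ

theorem parity_pullC (A : V →ₗ[ℝ] W) (τ : CForm W) : parity (pullC A τ) = pullC A (parity τ) := by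
  rw [parity, parity, pullC, baseChange_baseChange, baseChange_baseChange]
  congr 2
  exact LinearMap.ext (involute_map _)

theorem sigma_pullC (A : V →ₗ[ℝ] W) (τ : CForm W) : sigma (pullC A τ) = pullC A (sigma τ) := by
  rw [sigma, sigma, pullC, baseChange_baseChange, baseChange_baseChange]
  congr 2
  exact LinearMap.ext (reverse_map _)

theorem comp_pullC (A : V →ₗ[ℝ] W) (k : ℕ) (τ : CForm W) :
    comp k (pullC A τ) = pullC A (comp k τ) := by
  rw [comp, comp, pullC, baseChange_baseChange, baseChange_baseChange]
  congr 2
  exact LinearMap.ext (proj_map _ k)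

theorem pullC_act (A : V ≃ₗ[ℝ] W) (e : GTC W) (τ : CForm W) :
    pullC A.toLinearMap (act e τ) =
      act ((gtPull A.toLinearMap A.symm.toLinearMap).baseChange ℂ e) (pullC A.toLinearMap τ) := by
  have hreal (e : GT W) (α : RForm W) : pullR A.toLinearMap (actR e α) =
      actR (gtPull A.toLinearMap A.symm.toLinearMap e) (pullR A.toLinearMap α) := by
    have hcontract : CliffordAlgebra.contractLeft (Module.Dual.eval ℝ V (A.symm e.2))
        (pullR A.toLinearMap α) = pullR A.toLinearMap
          (CliffordAlgebra.contractLeft (Module.Dual.eval ℝ W e.2) α) := by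
      refine (contractLeft_map _ _ α).trans (congrArg (fun l => pullR A.toLinearMap
        (CliffordAlgebra.contractLeft l α)) (LinearMap.ext fun ξ => ?_))
      exact congrArg ξ (A.apply_symm_apply e.2)
    have hwedge : pullR A.toLinearMap (ExteriorAlgebra.ι ℝ e.1) =
        ExteriorAlgebra.ι ℝ (A.toLinearMap.dualMap e.1) := ExteriorAlgebra.map_apply_ι _ _
    change pullR A.toLinearMap (_ + _ * _) = _ + _
    rw [map_add, map_mul, ← hcontract, hwedge]
    rfl
  have h : act.compr₂ (pullC A.toLinearMap) =
      act.compl₁₂ ((gtPull A.toLinearMap A.symm.toLinearMap).baseChange ℂ)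
        (pullC A.toLinearMap) := by
    refine TensorProduct.AlgebraTensorModule.ext fun z e =>
      TensorProduct.AlgebraTensorModule.ext fun w α => ?_
    simp [act, pullC, hreal]
  exact LinearMap.congr_fun₂ h e τ

end Forms

section BField

variable {V W : Type*} [AddCommGroup V] [Module ℝ V] [AddCommGroup W] [Module ℝ W]

/-- The `1`-form `i_X b`, for a `2`-form `b` and a vector `X`. It is defined for every form `b`, as
the component of degree one of `i_X b`, so as to be linear in `b`. -/
def contract : RForm V →ₗ[ℝ] V →ₗ[ℝ] Module.Dual ℝ V :=
  ((CliffordAlgebra.contractLeft ∘ₗ Module.Dual.eval ℝ V).compr₂ ExteriorAlgebra.ιInv).flip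

variable {b : RForm V}

theorem ι_contract (hb : b ∈ ⋀[ℝ]^2 (Module.Dual ℝ V)) (X : V) :
    ExteriorAlgebra.ι ℝ (contract b X) =
      CliffordAlgebra.contractLeft (Module.Dual.eval ℝ V X) b := by
  obtain ⟨u, hu⟩ := exists_ι_eq_contractLeft hb (Module.Dual.eval ℝ V X)
  change ExteriorAlgebra.ι ℝ
    (ExteriorAlgebra.ιInv (CliffordAlgebra.contractLeft (Module.Dual.eval ℝ V X) b)) = _
  rw [← hu, ExteriorAlgebra.ι_leftInverse]

theorem contract_skew (hb : b ∈ ⋀[ℝ]^2 (Module.Dual ℝ V)) (X Y : V) :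
    contract b X Y = -contract b Y X := by
  have h := CliffordAlgebra.contractLeft_comm (Q := 0) (Module.Dual.eval ℝ V Y)
    (Module.Dual.eval ℝ V X) b
  rw [← ι_contract hb, ← ι_contract hb] at h
  simp only [ExteriorAlgebra.ι, CliffordAlgebra.contractLeft_ι, Module.Dual.eval_apply] at h
  rw [← map_neg (algebraMap ℝ _)] at h
  exact (ExteriorAlgebra.algebraMap_inj _ _ _).mp h

theorem contract_pullR (A : V →ₗ[ℝ] W) {b : RForm W} (hb : b ∈ ⋀[ℝ]^2 (Module.Dual ℝ W)) (X : V) :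
    contract (pullR A b) X = A.dualMap (contract b (A X)) := by
  rw [← ExteriorAlgebra.ι_inj ℝ, ι_contract (pullR_mem_exteriorPower A hb)]
  exact (contractLeft_map _ _ b).trans
    ((congrArg (pullR A) (ι_contract hb (A X))).symm.trans (ExteriorAlgebra.map_apply_ι _ _))

/-- The `b`-field transform `X + ξ ↦ X + ξ - i_X b`. -/
def bShift (b : RForm V) : GT V →ₗ[ℝ] GT V :=
  (LinearMap.fst ℝ _ _ - contract b ∘ₗ LinearMap.snd ℝ _ _).prod (LinearMap.snd ℝ _ _)

theorem exp_mul_act (hb : b ∈ ⋀[ℝ]^2 (Module.Dual ℝ V)) (e : GTC V) (τ : CForm V) :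
    ofR (IsNilpotent.exp b) * act e τ =
      act ((bShift b).baseChange ℂ e) (ofR (IsNilpotent.exp b) * τ) := by
  have hreal (e : GT V) (α : RForm V) :
      IsNilpotent.exp b * actR e α = actR (bShift b e) (IsNilpotent.exp b * α) := by
    change IsNilpotent.exp b * (_ + ExteriorAlgebra.ι ℝ e.1 * α) =
      CliffordAlgebra.contractLeft (Module.Dual.eval ℝ V e.2) (IsNilpotent.exp b * α) +
        ExteriorAlgebra.ι ℝ (e.1 - contract b e.2) * (IsNilpotent.exp b * α)
    rw [contractLeft_exp_mul_of_mem_exteriorPower_two hb, map_sub, ι_contract hb, sub_mul, mul_add,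
      (exp_commute_of_mem_exteriorPower_two hb (ExteriorAlgebra.ι ℝ e.1)).left_comm]
    abel
  have h : act.compr₂ (LinearMap.mulLeft ℂ (ofR (IsNilpotent.exp b))) =
      act.compl₁₂ ((bShift b).baseChange ℂ) (LinearMap.mulLeft ℂ (ofR (IsNilpotent.exp b))) := by
    refine TensorProduct.AlgebraTensorModule.ext fun z e =>
      TensorProduct.AlgebraTensorModule.ext fun w α => ?_
    simp [act, ofR, hreal]
  exact LinearMap.congr_fun₂ h e τ

end BField

section SpinRepresentation

variable {V : Type*} [AddCommGroup V] [Module ℝ V]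

theorem spinC_algebraMap (r : ℝ) (τ : CForm V) :
    spinC (algebraMap ℝ _ r) τ = r • τ := by
  rw [spinC, AlgHom.commutes, Module.algebraMap_end_eq_smul_id, LinearMap.baseChange_smul,
    LinearMap.baseChange_id]
  rfl

theorem spinC_ι (f : GT V) (τ : CForm V) :
    spinC (CliffordAlgebra.ι _ f) τ = act ((1 : ℂ) ⊗ₜ f) τ := by
  rw [spinC, spinR, CliffordAlgebra.lift_ι_apply, act, LinearMap.liftBaseChange_tmul, one_smul]
  rfl

theorem spinC_mul (x y : CliffordAlgebra (QuadraticForm.dualProd ℝ V)) (τ : CForm V) :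
    spinC (x * y) τ = spinC x (spinC y τ) := by
  rw [spinC, map_mul, LinearMap.baseChange_mul]
  rfl

theorem spinC_add (x y : CliffordAlgebra (QuadraticForm.dualProd ℝ V)) (τ : CForm V) :
    spinC (x + y) τ = spinC x τ + spinC y τ := by
  rw [spinC, map_add, LinearMap.baseChange_add]
  rfl

end SpinRepresentation

section Isometry

variable {V W : Type*} [AddCommGroup V] [Module ℝ V] [AddCommGroup W] [Module ℝ W]

theorem pairing_eq_polar (e f : GT V) :
    pairing e f = 1 / 2 * QuadraticMap.polar (QuadraticForm.dualProd ℝ V) e f := by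
  simp only [pairing, LinearMap.smul_apply, LinearMap.dualProd_apply_apply, smul_eq_mul,
    QuadraticMap.polar, QuadraticForm.dualProd_apply, Prod.fst_add, Prod.snd_add, map_add,
    LinearMap.add_apply]
  ring

variable (Φ : (QuadraticForm.dualProd ℝ W).IsometryEquiv (QuadraticForm.dualProd ℝ V))
  {J K : GT W →ₗ[ℝ] GT W}

theorem pairing_isometryEquiv (e f : GT W) : pairing (Φ e) (Φ f) = pairing e f := by
  simp only [pairing_eq_polar, QuadraticMap.polar, ← map_add, Φ.map_app]

theorem conj_isometryEquiv_apply (J : GT W →ₗ[ℝ] GT W) (e : GT W) :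
    Φ.toLinearEquiv.conj J (Φ e) = Φ (J e) :=
  congrArg (fun f => Φ (J f)) (Φ.toLinearEquiv.symm_apply_apply e)

theorem IsAlmostGC.conj (hJ : IsAlmostGC J) : IsAlmostGC (Φ.toLinearEquiv.conj J) where
  sq e := by
    obtain ⟨e, rfl⟩ := Φ.toLinearEquiv.surjective e
    change Φ.toLinearEquiv.conj J (Φ.toLinearEquiv.conj J (Φ e)) = -Φ e
    rw [conj_isometryEquiv_apply, conj_isometryEquiv_apply, hJ.sq, map_neg]
  orth e f := by
    obtain ⟨e, rfl⟩ := Φ.toLinearEquiv.surjective e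
    obtain ⟨f, rfl⟩ := Φ.toLinearEquiv.surjective f
    change pairing (Φ.toLinearEquiv.conj J (Φ e)) (Φ.toLinearEquiv.conj J (Φ f)) =
      pairing (Φ e) (Φ f)
    simp only [conj_isometryEquiv_apply, pairing_isometryEquiv, hJ.orth]

theorem IsAlmostGK.conj (h : IsAlmostGK J K) :
    IsAlmostGK (Φ.toLinearEquiv.conj J) (Φ.toLinearEquiv.conj K) where
  left := h.left.conj Φ
  right := h.right.conj Φ
  comm e := by
    obtain ⟨e, rfl⟩ := Φ.toLinearEquiv.surjective e
    change Φ.toLinearEquiv.conj J (Φ.toLinearEquiv.conj K (Φ e)) =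
      Φ.toLinearEquiv.conj K (Φ.toLinearEquiv.conj J (Φ e))
    simp only [conj_isometryEquiv_apply, h.comm]
  pos e he := by
    obtain ⟨e, rfl⟩ := Φ.toLinearEquiv.surjective e
    have he' : e ≠ 0 := fun h0 => he (by rw [h0, map_zero])
    change 0 < pairing (-(Φ.toLinearEquiv.conj J (Φ.toLinearEquiv.conj K (Φ e)))) (Φ e)
    rw [conj_isometryEquiv_apply, conj_isometryEquiv_apply, ← map_neg, pairing_isometryEquiv]
    exact h.pos e he'

theorem map_mem_nijenhuisSpace {N : CliffordAlgebra (QuadraticForm.dualProd ℝ W)}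
    (hN : N ∈ nijenhuisSpace J) :
    CliffordAlgebra.map Φ.toIsometry N ∈ nijenhuisSpace (Φ.toLinearEquiv.conj J) := by
  induction hN using Submodule.span_induction with
  | zero => simp only [map_zero, Submodule.zero_mem]
  | add x y _ _ hx hy => rw [map_add]; exact Submodule.add_mem _ hx hy
  | smul r x _ hx => rw [map_smul]; exact Submodule.smul_mem _ r hx
  | mem x hx =>
    obtain ⟨u, v, w, rfl⟩ := hx
    refine Submodule.subset_span ⟨Φ u, Φ v, Φ w, ?_⟩
    simp only [map_sub, map_mul, CliffordAlgebra.map_apply_ι, conj_isometryEquiv_apply]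
    rfl

end Isometry

/-- A linear isomorphism `A : V → W` extended by a `2`-form `b` on `V`, written `e^b A`. It carries
the spinors and the generalized tangent vectors of `W` to those of `V`; the tangent maps of an
`ExtDiffeo` and the charts of a manifold are of this kind. -/
@[ext]
structure ExtIso (V W : Type*) [AddCommGroup V] [Module ℝ V] [AddCommGroup W] [Module ℝ W] where
  equiv : V ≃ₗ[ℝ] W
  b : RForm V
  b_mem : b ∈ ⋀[ℝ]^2 (Module.Dual ℝ V)

namespace ExtIso

variable {V W Z : Type*} [AddCommGroup V] [Module ℝ V] [AddCommGroup W] [Module ℝ W]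
  [AddCommGroup Z] [Module ℝ Z]

/-- A linear isomorphism, extended by the zero form. -/
def ofEquiv (A : V ≃ₗ[ℝ] W) : ExtIso V W := ⟨A, 0, zero_mem _⟩

/-- The composite `e^b A e^c B = e^(b + A^* c) (B ∘ A)`, in the order in which `A` and `B` are
composed. -/
def trans (d : ExtIso V W) (e : ExtIso W Z) : ExtIso V Z :=
  ⟨d.equiv.trans e.equiv, d.b + pullR d.equiv.toLinearMap e.b,
    add_mem d.b_mem (pullR_mem_exteriorPower _ e.b_mem)⟩

/-- The inverse of `e^b A`. -/
def symm (e : ExtIso V W) : ExtIso W V :=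
  ⟨e.equiv.symm, -pullR e.equiv.symm.toLinearMap e.b, neg_mem (pullR_mem_exteriorPower _ e.b_mem)⟩

theorem symm_ofEquiv (A : V ≃ₗ[ℝ] W) : (ofEquiv A).symm = ofEquiv A.symm :=
  ExtIso.ext rfl ((congrArg Neg.neg (map_zero _)).trans neg_zero)

theorem trans_symm (e : ExtIso V W) : e.trans e.symm = ofEquiv (LinearEquiv.refl ℝ V) := by
  refine ExtIso.ext (LinearEquiv.self_trans_symm _) ?_
  change e.b + pullR e.equiv.toLinearMap (-pullR e.equiv.symm.toLinearMap e.b) = 0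
  rw [map_neg, pullR_comp, LinearEquiv.symm_comp, pullR_id, add_neg_cancel]

theorem symm_trans (e : ExtIso V W) : e.symm.trans e = ofEquiv (LinearEquiv.refl ℝ W) :=
  ExtIso.ext (LinearEquiv.symm_trans_self _) (neg_add_cancel _)

/-- The action of `e^b A` on generalized tangent vectors, as a linear map. -/
def gtMap (e : ExtIso V W) : GT W →ₗ[ℝ] GT V :=
  bShift e.b ∘ₗ gtPull e.equiv.toLinearMap e.equiv.symm.toLinearMap

theorem gtMap_apply (e : ExtIso V W) (f : GT W) :
    e.gtMap f = (e.equiv.toLinearMap.dualMap f.1 - contract e.b (e.equiv.symm f.2),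
      e.equiv.symm f.2) := rfl

theorem gtMap_trans (d : ExtIso V W) (e : ExtIso W Z) :
    (d.trans e).gtMap = d.gtMap ∘ₗ e.gtMap := by
  refine LinearMap.ext fun f => Prod.ext (LinearMap.ext fun Y => ?_) rfl
  simp only [trans, gtMap_apply, map_add, LinearEquiv.trans_symm, LinearEquiv.trans_apply,
    LinearMap.add_apply, contract_pullR _ e.b_mem, LinearEquiv.coe_coe,
    LinearEquiv.apply_symm_apply, LinearMap.sub_apply, LinearMap.dualMap_apply,
    LinearMap.coe_comp, Function.comp_apply, map_sub]
  ring

theorem gtMap_ofEquiv (A : V ≃ₗ[ℝ] W) :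
    (ofEquiv A).gtMap = gtPull A.toLinearMap A.symm.toLinearMap := by
  refine LinearMap.ext fun f => Prod.ext ?_ rfl
  rw [gtMap_apply, ofEquiv, map_zero, LinearMap.zero_apply, sub_zero]
  rfl

theorem gtMap_refl : (ofEquiv (LinearEquiv.refl ℝ V)).gtMap = LinearMap.id :=
  (gtMap_ofEquiv _).trans (LinearMap.ext fun _ => rfl)

theorem dualProd_gtMap (e : ExtIso V W) (f : GT W) :
    QuadraticForm.dualProd ℝ V (e.gtMap f) = QuadraticForm.dualProd ℝ W f := by
  have hskew := contract_skew e.b_mem (e.equiv.symm f.2) (e.equiv.symm f.2)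
  have hzero : contract e.b (e.equiv.symm f.2) (e.equiv.symm f.2) = 0 := by linarith
  simp [gtMap_apply, hzero]

/-- The isometry of generalized tangent spaces given by `e^b A`. -/
def gt (e : ExtIso V W) :
    (QuadraticForm.dualProd ℝ W).IsometryEquiv (QuadraticForm.dualProd ℝ V) where
  toLinearEquiv := LinearEquiv.ofLinearMap e.gtMap e.symm.gtMap
    (by rw [← gtMap_trans, trans_symm, gtMap_refl]) (by rw [← gtMap_trans, symm_trans, gtMap_refl])
  map_app' := e.dualProd_gtMap

theorem gt_symm (e : ExtIso V W) : e.symm.gt.toLinearEquiv = e.gt.toLinearEquiv.symm :=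
  LinearEquiv.ext fun _ => rfl

/-- The action of `e^b A` on complex generalized tangent vectors. -/
def gtC (e : ExtIso V W) : GTC W ≃ₗ[ℂ] GTC V := e.gt.toLinearEquiv.baseChange ℝ ℂ _ _

theorem gtC_apply (e : ExtIso V W) (f : GTC W) : e.gtC f = e.gtMap.baseChange ℂ f := rfl

theorem gtC_trans (d : ExtIso V W) (e : ExtIso W Z) (f : GTC Z) :
    (d.trans e).gtC f = d.gtC (e.gtC f) := by
  rw [gtC_apply, gtC_apply, gtC_apply, gtMap_trans, baseChange_baseChange]

theorem gtC_symm_gtC (e : ExtIso V W) (f : GTC W) : e.symm.gtC (e.gtC f) = f :=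
  e.gtC.symm_apply_apply f

theorem conjC_gtC (e : ExtIso V W) (f : GTC W) : conjC _ (e.gtC f) = e.gtC (conjC _ f) :=
  conjC_baseChange _ _

theorem pairingC_gtC (e : ExtIso V W) (f g : GTC W) :
    pairingC (e.gtC f) (e.gtC g) = pairingC f g := by
  have h : pairingC.compl₁₂ e.gtC.toLinearMap e.gtC.toLinearMap = pairingC := by
    refine TensorProduct.AlgebraTensorModule.ext fun z f =>
      TensorProduct.AlgebraTensorModule.ext fun w g => ?_
    exact congrArg (fun r : ℝ => r • (z * w)) (pairing_isometryEquiv e.gt f g)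
  exact LinearMap.congr_fun₂ h f g

/-- The action `τ ↦ e^b ∧ A^* τ` of `e^b A` on spinors. -/
def spin (e : ExtIso V W) : CForm W →ₗ[ℂ] CForm V :=
  LinearMap.mulLeft ℂ (ofR (IsNilpotent.exp e.b)) ∘ₗ pullC e.equiv.toLinearMap

theorem spin_apply (e : ExtIso V W) (τ : CForm W) :
    e.spin τ = ofR (IsNilpotent.exp e.b) * pullC e.equiv.toLinearMap τ := rfl

theorem spin_ofEquiv (A : V ≃ₗ[ℝ] W) (τ : CForm W) :
    (ofEquiv A).spin τ = pullC A.toLinearMap τ := by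
  rw [spin_apply, ofEquiv, IsNilpotent.exp_zero]
  exact one_mul _

theorem spin_trans (d : ExtIso V W) (e : ExtIso W Z) (τ : CForm Z) :
    (d.trans e).spin τ = d.spin (e.spin τ) := by
  simp only [spin_apply, trans, pullC_mul, pullC_ofR, ← mul_assoc, ← ofR_mul, pullC_comp]
  rw [exp_add_of_mem_exteriorPower_two d.b_mem (pullR_mem_exteriorPower _ e.b_mem),
    pullR, map_exp_of_mem_exteriorPower_two _ e.b_mem]
  rfl

theorem spin_symm_spin (e : ExtIso V W) (τ : CForm W) : e.symm.spin (e.spin τ) = τ := by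
  rw [← spin_trans, symm_trans, spin_ofEquiv]
  exact pullC_id τ

theorem spin_injective (e : ExtIso V W) : Function.Injective e.spin :=
  Function.LeftInverse.injective e.spin_symm_spin

theorem spin_act (e : ExtIso V W) (f : GTC W) (τ : CForm W) :
    e.spin (act f τ) = act (e.gtC f) (e.spin τ) := by
  rw [spin_apply, pullC_act, exp_mul_act e.b_mem, baseChange_baseChange, spin_apply]
  rfl

theorem spin_spinC (e : ExtIso V W) (N : CliffordAlgebra (QuadraticForm.dualProd ℝ W))
    (τ : CForm W) :
    e.spin (spinC N τ) = spinC (CliffordAlgebra.map e.gt.toIsometry N) (e.spin τ) := by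
  induction N using CliffordAlgebra.induction generalizing τ with
  | algebraMap r => simp only [AlgHom.commutes, spinC_algebraMap, LinearMap.map_smul_of_tower]
  | ι f => rw [CliffordAlgebra.map_apply_ι, spinC_ι, spinC_ι, e.spin_act]; rfl
  | mul x y hx hy => simp only [map_mul, spinC_mul, hx, hy]
  | add x y hx hy => simp only [map_add, spinC_add, hx, hy]

theorem spin_act_add_spinC (e : ExtIso V W) (f : GTC W)
    (N : CliffordAlgebra (QuadraticForm.dualProd ℝ W)) (τ : CForm W) :
    e.spin (act f τ + spinC N τ) =
      act (e.gtC f) (e.spin τ) + spinC (CliffordAlgebra.map e.gt.toIsometry N) (e.spin τ) := by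
  rw [map_add, spin_act, spin_spinC]

theorem conjC_spin (e : ExtIso V W) (τ : CForm W) : conjC _ (e.spin τ) = e.spin (conjC _ τ) := by
  rw [spin_apply, conjC_ofR_mul, pullC, conjC_baseChange, spin_apply]
  rfl

theorem parity_spin (e : ExtIso V W) (τ : CForm W) : parity (e.spin τ) = e.spin (parity τ) := by
  have h : parity (ofR (IsNilpotent.exp e.b)) = ofR (IsNilpotent.exp e.b) :=
    congrArg ofR (involute_exp_of_mem_exteriorPower_two e.b_mem)
  rw [spin_apply, parity_mul, h, parity_pullC, spin_apply]

theorem spinPairing_spin (e : ExtIso V W) (σ τ : CForm W) :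
    spinPairing (e.spin σ) (e.spin τ) = pullC e.equiv.toLinearMap (spinPairing σ τ) := by
  have hsigma : sigma (ofR (IsNilpotent.exp e.b)) = ofR (IsNilpotent.exp (-e.b)) :=
    congrArg ofR (reverse_exp_of_mem_exteriorPower_two e.b_mem)
  have hcentral (ρ : CForm V) : Commute (ofR (IsNilpotent.exp e.b)) ρ :=
    commute_ofR (exp_commute_of_mem_exteriorPower_two e.b_mem) ρ
  have hcancel : ofR (IsNilpotent.exp e.b) * ofR (IsNilpotent.exp (-e.b)) = 1 := by
    rw [← ofR_mul, IsNilpotent.exp_mul_exp_neg_self (isNilpotent_of_mem_exteriorPower_two e.b_mem)]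
    rfl
  have hmul : e.spin σ * sigma (e.spin τ) = pullC e.equiv.toLinearMap (σ * sigma τ) := by
    rw [spin_apply, spin_apply, sigma_mul, hsigma, sigma_pullC, (hcentral _).eq,
      mul_assoc, (hcentral _).left_comm, hcancel, mul_one, pullC_mul]
  rw [spinPairing, spinPairing, hmul, comp_pullC, e.equiv.finrank_eq]

theorem gtC_mem_spinorKer_spin (e : ExtIso V W) {τ : CForm W} {f : GTC W} :
    e.gtC f ∈ spinorKer (e.spin τ) ↔ f ∈ spinorKer τ := by
  change act (e.gtC f) (e.spin τ) = 0 ↔ act f τ = 0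
  rw [← spin_act, map_eq_zero_iff _ e.spin_injective]

end ExtIso

section Spinors

variable {V W : Type*} [AddCommGroup V] [Module ℝ V] [AddCommGroup W] [Module ℝ W] {τ : CForm W}

theorem IsPure.spin (hτ : IsPure τ) (e : ExtIso V W) : IsPure (e.spin τ) where
  ne_zero h := hτ.ne_zero ((map_eq_zero_iff _ e.spin_injective).mp h)
  even_or_odd := by
    rw [e.parity_spin, ← map_neg, e.spin_injective.eq_iff, e.spin_injective.eq_iff]
    exact hτ.even_or_odd
  finrank_ker := by
    have h : spinorKer τ = (spinorKer (e.spin τ)).comap e.gtC.toLinearMap :=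
      Submodule.ext fun f => e.gtC_mem_spinorKer_spin.symm
    have h' : spinorKer (e.spin τ) = (spinorKer τ).map e.gtC.toLinearMap := by
      rw [h, Submodule.map_comap_eq_of_surjective e.gtC.surjective]
    rw [h', e.equiv.finrank_eq, ← hτ.finrank_ker]
    exact LinearEquiv.finrank_map_eq e.gtC _

theorem IsNondegenerate.spin (hτ : IsNondegenerate τ) (e : ExtIso V W) :
    IsNondegenerate (e.spin τ) := by
  intro f hf hfc
  obtain ⟨f, rfl⟩ := e.gtC.surjective f
  rw [e.conjC_gtC, e.gtC_mem_spinorKer_spin] at hfc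
  rw [hτ f (e.gtC_mem_spinorKer_spin.mp hf) hfc, map_zero]

theorem Induces.spin {J : GT W →ₗ[ℝ] GT W} (hτ : Induces τ J) (e : ExtIso V W) :
    Induces (e.spin τ) (e.gt.toLinearEquiv.conj J) := by
  have hJ (f : GTC W) : LinearMap.baseChange ℂ (e.gt.toLinearEquiv.conj J) (e.gtC f) =
      e.gtC (LinearMap.baseChange ℂ J f) := by
    rw [e.gtC_apply, e.gtC_apply, baseChange_baseChange, baseChange_baseChange]
    congr 2
    exact LinearMap.ext (conj_isometryEquiv_apply e.gt J)
  intro f hf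
  obtain ⟨f, rfl⟩ := e.gtC.surjective f
  obtain ⟨hker, hconj⟩ := hτ f (e.gtC_mem_spinorKer_spin.mp hf)
  exact ⟨by rw [hJ, hker, map_neg, map_smul], by rw [e.conjC_gtC, hJ, hconj, map_smul]⟩

end Spinors

section SmoothOn

variable {E : Type*} [NormedAddCommGroup E] [NormedSpace ℝ E]
variable {P Q S : Type*} [AddCommGroup P] [Module ℝ P] [AddCommGroup Q] [Module ℝ Q]
  [AddCommGroup S] [Module ℝ S] {s t : Set E} {f g : E → P}

theorem SmoothOn.mono (hf : SmoothOn f s) (h : t ⊆ s) : SmoothOn f t := fun l => (hf l).mono h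

theorem SmoothOn.congr (hf : SmoothOn f s) (h : ∀ y ∈ s, g y = f y) : SmoothOn g s :=
  fun l => (hf l).congr fun y hy => by rw [h y hy]

theorem smoothOn_of_locally (h : ∀ y ∈ s, ∃ t, IsOpen t ∧ y ∈ t ∧ SmoothOn f (s ∩ t)) :
    SmoothOn f s := by
  refine fun l => contDiffOn_of_locally_contDiffOn fun y hy => ?_
  obtain ⟨t, ht, hyt, hf⟩ := h y hy
  exact ⟨t, ht, hyt, hf l⟩

theorem smoothOn_const (p : P) : SmoothOn (fun _ : E => p) s := fun _ => contDiffOn_const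

theorem SmoothOn.add (hf : SmoothOn f s) (hg : SmoothOn g s) : SmoothOn (fun y => f y + g y) s :=
  fun l => ((hf l).add (hg l)).congr fun _ _ => map_add l _ _

theorem SmoothOn.sub (hf : SmoothOn f s) (hg : SmoothOn g s) : SmoothOn (fun y => f y - g y) s :=
  fun l => ((hf l).sub (hg l)).congr fun _ _ => map_sub l _ _

theorem SmoothOn.sum {ι : Type*} (u : Finset ι) {f : ι → E → P} (hf : ∀ i ∈ u, SmoothOn (f i) s) :
    SmoothOn (fun y => ∑ i ∈ u, f i y) s := fun l =>
  (ContDiffOn.sum fun i hi => hf i hi l).congr fun _ _ => map_sum l _ _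

theorem SmoothOn.smul {c : E → ℝ} (hc : ContDiffOn ℝ ∞ c s) (hf : SmoothOn f s) :
    SmoothOn (fun y => c y • f y) s :=
  fun l => (hc.mul (hf l)).congr fun y _ => by rw [map_smul, smul_eq_mul]

theorem SmoothOn.linear (L : P →ₗ[ℝ] Q) (hf : SmoothOn f s) : SmoothOn (fun y => L (f y)) s :=
  fun l => hf (l ∘ₗ L)

theorem SmoothOn.prodMk {g : E → Q} (hf : SmoothOn f s) (hg : SmoothOn g s) :
    SmoothOn (fun y => (f y, g y)) s :=
  ((hf.linear (LinearMap.inl ℝ P Q)).add (hg.linear (LinearMap.inr ℝ P Q))).congr fun y _ => by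
    simp

theorem SmoothOn.apply [Module.Finite ℝ P] {L : E → P →ₗ[ℝ] Q}
    (hL : ∀ p, SmoothOn (fun y => L y p) s) (hf : SmoothOn f s) :
    SmoothOn (fun y => L y (f y)) s := by
  let b := Module.finBasis ℝ P
  have hsum : SmoothOn (fun y => ∑ i, b.repr (f y) i • L y (b i)) s :=
    SmoothOn.sum _ fun i _ => SmoothOn.smul (hf (b.coord i)) (hL (b i))
  refine hsum.congr fun y _ => ?_
  simp only [← map_smul, ← map_sum, b.sum_repr]

theorem SmoothOn.bilinear [Module.Finite ℝ P] (B : P →ₗ[ℝ] Q →ₗ[ℝ] S) {g : E → Q}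
    (hf : SmoothOn f s) (hg : SmoothOn g s) : SmoothOn (fun y => B (f y) (g y)) s :=
  SmoothOn.apply (L := fun y => B.flip (g y)) (fun p => hg.linear (B p)) hf

theorem SmoothOn.comp {E' : Type*} [NormedAddCommGroup E'] [NormedSpace ℝ E'] {t : Set E'}
    {h : E' → E} (hf : SmoothOn f s) (hh : ContDiffOn ℝ ∞ h t) (hst : Set.MapsTo h t s) :
    SmoothOn (fun y => f (h y)) t :=
  fun l => (hf l).comp hh hst

theorem smoothOn_of_contDiffOn {G : Type*} [NormedAddCommGroup G] [NormedSpace ℝ G]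
    [FiniteDimensional ℝ G] {f : E → G} (hf : ContDiffOn ℝ ∞ f s) : SmoothOn f s := fun l =>
  (LinearMap.toContinuousLinearMap l).contDiff.comp_contDiffOn hf

theorem smoothOn_toLinearMap {G G' : Type*} [NormedAddCommGroup G] [NormedSpace ℝ G]
    [FiniteDimensional ℝ G] [NormedAddCommGroup G'] [NormedSpace ℝ G'] [FiniteDimensional ℝ G']
    {L : E → G →L[ℝ] G'} (hL : ContDiffOn ℝ ∞ L s) : SmoothOn (fun y => (L y).toLinearMap) s :=
  SmoothOn.linear (f := L) (ContinuousLinearMap.coeLM ℝ) (smoothOn_of_contDiffOn hL)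

theorem SmoothOn.baseChange [Module.Finite ℝ P] [Module.Finite ℝ Q] {f : E → P →ₗ[ℝ] Q}
    {t : E → ℂ ⊗[ℝ] P} (hf : SmoothOn f s) (ht : SmoothOn t s) :
    SmoothOn (fun y => LinearMap.baseChange ℂ (f y) (t y)) s :=
  SmoothOn.bilinear (LinearMap.lTensorHom (R := ℝ) ℂ) hf ht

section Algebra

variable {A : Type*} [Ring A] [Algebra ℝ A] [Module.Finite ℝ A]

theorem SmoothOn.mul {a b : E → A} (ha : SmoothOn a s) (hb : SmoothOn b s) :
    SmoothOn (fun y => a y * b y) s :=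
  SmoothOn.bilinear (LinearMap.mul ℝ A) ha hb

theorem SmoothOn.pow {a : E → A} (ha : SmoothOn a s) (k : ℕ) : SmoothOn (fun y => a y ^ k) s := by
  induction k with
  | zero => exact (smoothOn_const 1).congr fun y _ => pow_zero _
  | succ k ih => exact (ih.mul ha).congr fun y _ => pow_succ _ _

end Algebra

variable {V W : Type*} [AddCommGroup V] [Module ℝ V] [AddCommGroup W] [Module ℝ W]

theorem smoothOn_ofR {α : E → RForm V} : SmoothOn (fun y => ofR (α y)) s ↔ SmoothOn α s := by
  refine ⟨fun h => (h.linear (reC (RForm V))).congr fun y _ => ?_,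
    fun h => h.linear (TensorProduct.mk ℝ ℂ (RForm V) 1)⟩
  simp [reC, ofR]

theorem SmoothOn.act [FiniteDimensional ℝ V] {e : E → GTC V} {τ : E → CForm V}
    (he : SmoothOn e s) (hτ : SmoothOn τ s) : SmoothOn (fun y => act (e y) (τ y)) s :=
  SmoothOn.bilinear ((GenKahler.act (V := V)).restrictScalars₁₂ ℝ ℝ) he hτ

theorem SmoothOn.bShift {b : E → RForm V} (hb : SmoothOn b s) :
    SmoothOn (fun y => bShift (b y)) s := by
  let L : RForm V →ₗ[ℝ] (GT V →ₗ[ℝ] GT V) :=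
    LinearMap.compRight ℝ (LinearMap.inl ℝ (Module.Dual ℝ V) V) ∘ₗ
      LinearMap.lcomp ℝ (Module.Dual ℝ V) (LinearMap.snd ℝ (Module.Dual ℝ V) V) ∘ₗ contract
  refine ((smoothOn_const LinearMap.id).sub (hb.linear L)).congr fun y _ => ?_
  exact LinearMap.ext fun e => Prod.ext rfl (sub_zero e.2).symm

theorem SmoothOn.gtPull {A : E → V →ₗ[ℝ] W} {B : E → W →ₗ[ℝ] V} (hA : SmoothOn A s)
    (hB : SmoothOn B s) : SmoothOn (fun y => gtPull (A y) (B y)) s := by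
  have hA' : SmoothOn (fun y => (A y).dualMap) s :=
    (hA.linear (Module.Dual.transpose (R := ℝ) (M := V) (M' := W))).congr fun _ _ => rfl
  exact ((hA'.prodMk hB).linear
    (LinearMap.prodMapLinear ℝ (Module.Dual ℝ W) W (Module.Dual ℝ V) V ℝ)).congr fun _ _ => rfl

variable [FiniteDimensional ℝ V]

theorem SmoothOn.pullR_const {A : E → V →ₗ[ℝ] W} (hA : SmoothOn A s) (α : RForm W) :
    SmoothOn (fun y => pullR (A y) α) s := by
  induction α using ExteriorAlgebra.induction with
  | algebraMap r =>
    exact (smoothOn_const (algebraMap ℝ (RForm V) r)).congr fun y _ => AlgHom.commutes _ _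
  | ι u =>
    refine (hA.linear (ExteriorAlgebra.ι ℝ ∘ₗ LinearMap.applyₗ u ∘ₗ
      Module.Dual.transpose (R := ℝ) (M := V) (M' := W))).congr fun y _ => ?_
    exact ExteriorAlgebra.map_apply_ι _ _
  | mul a c ha hc => exact (ha.mul hc).congr fun y _ => map_mul _ _ _
  | add a c ha hc => exact (ha.add hc).congr fun y _ => map_add _ _ _

theorem SmoothOn.pullC_const {A : E → V →ₗ[ℝ] W} (hA : SmoothOn A s) (τ : CForm W) :
    SmoothOn (fun y => pullC (A y) τ) s := by
  induction τ using TensorProduct.induction_on with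
  | zero => exact (smoothOn_const 0).congr fun y _ => map_zero _
  | tmul z α => exact (hA.pullR_const α).linear (TensorProduct.mk ℝ ℂ (RForm V) z)
  | add a c ha hc => exact (ha.add hc).congr fun y _ => map_add _ _ _

theorem SmoothOn.pullC [FiniteDimensional ℝ W] {A : E → V →ₗ[ℝ] W} (hA : SmoothOn A s)
    {τ : E → CForm W} (hτ : SmoothOn τ s) : SmoothOn (fun y => pullC (A y) (τ y)) s :=
  SmoothOn.apply (L := fun y => (GenKahler.pullC (A y)).restrictScalars ℝ) hA.pullC_const hτ

theorem SmoothOn.exp {b : E → RForm V} (h : SmoothOn b s)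
    (hb : ∀ y ∈ s, b y ∈ ⋀[ℝ]^2 (Module.Dual ℝ V)) :
    SmoothOn (fun y => IsNilpotent.exp (b y)) s := by
  have hs : SmoothOn (fun y => ∑ i ∈ Finset.range (Module.finrank ℝ (Module.Dual ℝ V) + 1),
      (((i.factorial : ℚ)⁻¹ : ℚ) : ℝ) • b y ^ i) s :=
    SmoothOn.sum _ fun i _ => SmoothOn.smul contDiffOn_const (h.pow i)
  refine hs.congr fun y hy => ?_
  rw [IsNilpotent.exp_eq_sum (pow_finrank_add_one_of_mem_exteriorPower_two (hb y hy))]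
  exact Finset.sum_congr rfl fun i _ => (Rat.cast_smul_eq_qsmul ℝ _ _).symm

end SmoothOn

section Charts

variable {n : ℕ} {M : Type*} [TopologicalSpace M] [ChartedSpace (EuclideanSpace ℝ (Fin (2 * n))) M]

theorem isOpen_chartDomain (p : M) {U : Set M} (hU : IsOpen U) : IsOpen (chartDomain n p U) :=
  (continuousOn_extChartAt_symm p).isOpen_inter_preimage (isOpen_extChartAt_target p) hU

theorem smoothOn_chartDomain_of_locally {P : Type*} [AddCommGroup P] [Module ℝ P] {p : M}
    {f : EuclideanSpace ℝ (Fin (2 * n)) → P} {U : Set M}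
    (h : ∀ z ∈ U, ∃ S : Set M, IsOpen S ∧ z ∈ S ∧ SmoothOn f (chartDomain n p (U ∩ S))) :
    SmoothOn f (chartDomain n p U) := by
  refine smoothOn_of_locally fun y hy => ?_
  obtain ⟨S, hS, hyS, hf⟩ := h _ hy.2
  exact ⟨chartDomain n p S, isOpen_chartDomain p hS, ⟨hy.1, hyS⟩,
    hf.mono fun z hz => ⟨hz.1.1, hz.1.2, hz.2.2⟩⟩

theorem FormSmoothOn.conjF {U : Set M} {τ : CField n M} (hτ : FormSmoothOn U τ) :
    FormSmoothOn U (conjF τ) := fun p =>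
  ((hτ p).linear (conjC _)).congr fun _ _ => (conjC_baseChange _ _).symm

variable [IsManifold (𝓡 (2 * n)) ∞ M]

theorem dChart_comp_dChartInv {p : M} {y : EuclideanSpace ℝ (Fin (2 * n))}
    (hy : y ∈ (extChartAt (𝓡 (2 * n)) p).target) :
    dChart n p ((extChartAt (𝓡 (2 * n)) p).symm y) ∘ₗ dChartInv p y = LinearMap.id := by
  have h := mfderiv_extChartAt_comp_mfderivWithin_extChartAt_symm (I := 𝓡 (2 * n)) hy
  rw [ModelWithCorners.Boundaryless.range_eq_univ, mfderivWithin_univ] at h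
  exact congrArg ContinuousLinearMap.toLinearMap h

theorem dChartInv_comp_dChart {p : M} {y : EuclideanSpace ℝ (Fin (2 * n))}
    (hy : y ∈ (extChartAt (𝓡 (2 * n)) p).target) :
    dChartInv p y ∘ₗ dChart n p ((extChartAt (𝓡 (2 * n)) p).symm y) = LinearMap.id := by
  have h := mfderivWithin_extChartAt_symm_comp_mfderiv_extChartAt (I := 𝓡 (2 * n)) hy
  rw [ModelWithCorners.Boundaryless.range_eq_univ, mfderivWithin_univ] at h
  exact congrArg ContinuousLinearMap.toLinearMap h

theorem dChart_bijective {p x : M} (hx : x ∈ (extChartAt (𝓡 (2 * n)) p).source) :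
    Function.Bijective (dChart n p x) := by
  obtain ⟨y, hy, rfl⟩ : ∃ y ∈ (extChartAt (𝓡 (2 * n)) p).target,
      (extChartAt (𝓡 (2 * n)) p).symm y = x :=
    ⟨_, (extChartAt (𝓡 (2 * n)) p).map_source hx, (extChartAt (𝓡 (2 * n)) p).left_inv hx⟩
  exact Function.bijective_iff_has_inverse.mpr ⟨dChartInv p y,
    LinearMap.congr_fun (dChartInv_comp_dChart hy), LinearMap.congr_fun (dChart_comp_dChartInv hy)⟩

/-- The derivative of the chart around `p` at a point `x` of its domain, as a linear
equivalence. -/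
def chartEquiv {p x : M} (hx : x ∈ (extChartAt (𝓡 (2 * n)) p).source) :
    T n x ≃ₗ[ℝ] EuclideanSpace ℝ (Fin (2 * n)) :=
  LinearEquiv.ofBijective (dChart n p x) (dChart_bijective hx)

theorem chartEquiv_symm_toLinearMap {p : M} {y : EuclideanSpace ℝ (Fin (2 * n))}
    (hy : y ∈ (extChartAt (𝓡 (2 * n)) p).target) :
    (chartEquiv ((extChartAt (𝓡 (2 * n)) p).map_target hy)).symm.toLinearMap = dChartInv p y := by
  refine LinearMap.ext fun v => ?_
  rw [LinearEquiv.coe_coe, LinearEquiv.symm_apply_eq]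
  exact (LinearMap.congr_fun (dChart_comp_dChartInv hy) v).symm

theorem inChart_eq_spin (τ : CField n M) {p x : M} {y : EuclideanSpace ℝ (Fin (2 * n))}
    (hx : x ∈ (extChartAt (𝓡 (2 * n)) p).source) (hy : y ∈ (extChartAt (𝓡 (2 * n)) p).target)
    (hyx : (extChartAt (𝓡 (2 * n)) p).symm y = x) :
    inChart τ p y = (ExtIso.ofEquiv (chartEquiv hx).symm).spin (τ x) := by
  subst hyx
  rw [ExtIso.spin_ofEquiv, chartEquiv_symm_toLinearMap hy, inChart]

theorem gtInChart_eq_gtC (e : GTField n M) {p x : M} {y : EuclideanSpace ℝ (Fin (2 * n))}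
    (hx : x ∈ (extChartAt (𝓡 (2 * n)) p).source) (hy : y ∈ (extChartAt (𝓡 (2 * n)) p).target)
    (hyx : (extChartAt (𝓡 (2 * n)) p).symm y = x) :
    gtInChart e p y = (ExtIso.ofEquiv (chartEquiv hx).symm).gtC (e x) := by
  subst hyx
  rw [ExtIso.gtC_apply, ExtIso.gtMap_ofEquiv, chartEquiv_symm_toLinearMap hy, gtInChart]
  rfl

theorem inChart_actF (e : GTField n M) (τ : CField n M) {p : M}
    {y : EuclideanSpace ℝ (Fin (2 * n))} (hy : y ∈ (extChartAt (𝓡 (2 * n)) p).target) :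
    inChart (actF e τ) p y = act (gtInChart e p y) (inChart τ p y) := by
  have hx := (extChartAt (𝓡 (2 * n)) p).map_target hy
  rw [inChart_eq_spin _ hx hy rfl, inChart_eq_spin _ hx hy rfl, gtInChart_eq_gtC _ hx hy rfl,
    ← ExtIso.spin_act, actF]

theorem FormSmoothOn.actF {U : Set M} {e : GTField n M} {τ : CField n M} (he : GTSmoothOn U e)
    (hτ : FormSmoothOn U τ) : FormSmoothOn U (actF e τ) := fun p =>
  ((he p).act (hτ p)).congr fun _ hy => inChart_actF e τ hy.1

end Charts

section ExtDiffeo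

variable {n : ℕ} {M : Type*} [TopologicalSpace M] [ChartedSpace (EuclideanSpace ℝ (Fin (2 * n))) M]

/-- The derivative of a diffeomorphism at a point, as a linear equivalence. -/
def tangentEquiv (F : M ≃ₘ⟮𝓡 (2 * n), 𝓡 (2 * n)⟯ M) (x : M) : T n x ≃ₗ[ℝ] T n (F x) :=
  (F.mfderivToContinuousLinearEquiv (by simp) x).toLinearEquiv

theorem tangentEquiv_toLinearMap (F : M ≃ₘ⟮𝓡 (2 * n), 𝓡 (2 * n)⟯ M) (x : M) :
    (tangentEquiv F x).toLinearMap = (mfderiv (𝓡 (2 * n)) (𝓡 (2 * n)) F x).toLinearMap :=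
  congrArg ContinuousLinearMap.toLinearMap (F.mfderivToContinuousLinearEquiv_coe (by simp))

theorem pullback_apply (F : M ≃ₘ⟮𝓡 (2 * n), 𝓡 (2 * n)⟯ M) (α : RField n M) (x : M) :
    pullback F α x = pullR (tangentEquiv F x).toLinearMap (α (F x)) := by
  rw [tangentEquiv_toLinearMap, pullback]

/-- The value of `e^b F` at `x`, that is, `e^b F_*` on the tangent space at `x`. -/
def ExtDiffeo.tangentIso (g : ExtDiffeo n M) (x : M) : ExtIso (T n x) (T n (g.F x)) :=
  ⟨tangentEquiv g.F x, g.b x, g.isForm.degree x⟩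

theorem ExtDiffeo.smul_apply (g : ExtDiffeo n M) (τ : CField n M) (x : M) :
    g.smul τ x = (g.tangentIso x).spin (τ (g.F x)) := by
  rw [ExtIso.spin_apply, tangentIso, tangentEquiv_toLinearMap, ExtDiffeo.smul]

/-- The action of `g = e^b F` on sections of `(T ⊕ T^*)^ℂ`. -/
def ExtDiffeo.gtSmul (g : ExtDiffeo n M) (e : GTField n M) : GTField n M := fun x =>
  (g.tangentIso x).gtC (e (g.F x))

/-- The diffeomorphism `F`, read in the charts around `p` and `q`. -/
def transition (F : M ≃ₘ⟮𝓡 (2 * n), 𝓡 (2 * n)⟯ M) (p q : M) (y : EuclideanSpace ℝ (Fin (2 * n))) :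
    EuclideanSpace ℝ (Fin (2 * n)) :=
  extChartAt (𝓡 (2 * n)) q (F ((extChartAt (𝓡 (2 * n)) p).symm y))

/-- The part of the chart around `p` that `F` maps into the chart around `q`. -/
def transitionDomain (F : M ≃ₘ⟮𝓡 (2 * n), 𝓡 (2 * n)⟯ M) (p q : M) :
    Set (EuclideanSpace ℝ (Fin (2 * n))) :=
  chartDomain n p (F ⁻¹' (extChartAt (𝓡 (2 * n)) q).source)

theorem isOpen_transitionDomain (F : M ≃ₘ⟮𝓡 (2 * n), 𝓡 (2 * n)⟯ M) (p q : M) :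
    IsOpen (transitionDomain F p q) :=
  isOpen_chartDomain p ((isOpen_extChartAt_source q).preimage F.continuous)

theorem mapsTo_transition (F : M ≃ₘ⟮𝓡 (2 * n), 𝓡 (2 * n)⟯ M) (p q : M) (U : Set M) :
    Set.MapsTo (transition F p q) (transitionDomain F p q ∩ chartDomain n p (F ⁻¹' U))
      (chartDomain n q U) := fun y hy =>
  ⟨(extChartAt (𝓡 (2 * n)) q).map_source hy.1.2, by
    rw [Set.mem_preimage, transition, (extChartAt (𝓡 (2 * n)) q).left_inv hy.1.2]
    exact hy.2.2⟩

theorem smoothOn_of_transitionDomain {P : Type*} [AddCommGroup P] [Module ℝ P]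
    (F : M ≃ₘ⟮𝓡 (2 * n), 𝓡 (2 * n)⟯ M) {p : M} {f : EuclideanSpace ℝ (Fin (2 * n)) → P} {U : Set M}
    (h : ∀ q, SmoothOn f (transitionDomain F p q ∩ chartDomain n p (F ⁻¹' U))) :
    SmoothOn f (chartDomain n p (F ⁻¹' U)) := by
  refine smoothOn_of_locally fun y hy => ?_
  let q := F ((extChartAt (𝓡 (2 * n)) p).symm y)
  exact ⟨transitionDomain F p q, isOpen_transitionDomain F p q, ⟨hy.1, mem_extChartAt_source q⟩,
    (h q).mono (Set.inter_comm _ _).subset⟩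

/-- The `2`-form of `g = e^b F`, written in the chart around `p`. -/
def ExtDiffeo.bInChart (g : ExtDiffeo n M) (p : M) (y : EuclideanSpace ℝ (Fin (2 * n))) :
    RForm (EuclideanSpace ℝ (Fin (2 * n))) :=
  pullR (dChartInv p y) (g.b ((extChartAt (𝓡 (2 * n)) p).symm y))

theorem ExtDiffeo.bInChart_mem (g : ExtDiffeo n M) (p : M) (y : EuclideanSpace ℝ (Fin (2 * n))) :
    g.bInChart p y ∈ ⋀[ℝ]^2 (Module.Dual ℝ (EuclideanSpace ℝ (Fin (2 * n)))) :=
  pullR_mem_exteriorPower _ (g.isForm.degree _)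

theorem ExtDiffeo.smoothOn_bInChart (g : ExtDiffeo n M) (p : M) :
    SmoothOn (g.bInChart p) (extChartAt (𝓡 (2 * n)) p).target :=
  smoothOn_ofR.mp ((g.isForm.smooth p).mono fun _ hy => ⟨hy, trivial⟩)

variable [IsManifold (𝓡 (2 * n)) ∞ M]

theorem contDiffOn_transition (F : M ≃ₘ⟮𝓡 (2 * n), 𝓡 (2 * n)⟯ M) (p q : M) :
    ContDiffOn ℝ ∞ (transition F p q) (transitionDomain F p q) := by
  rw [← contMDiffOn_iff_contDiffOn]
  have hF : ContMDiffOn 𝓘(ℝ, EuclideanSpace ℝ (Fin (2 * n))) (𝓡 (2 * n)) ∞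
      (fun y => F ((extChartAt (𝓡 (2 * n)) p).symm y)) (transitionDomain F p q) :=
    F.contMDiff.comp_contMDiffOn ((contMDiffOn_extChartAt_symm p).mono fun y hy => hy.1)
  refine (contMDiffOn_extChartAt (x := q)).comp hF fun y hy => ?_
  rw [← extChartAt_source (𝓡 (2 * n))]
  exact hy.2

/-- The value of `g = e^b F` at a point, read in the charts around `p` and `q`. -/
def ExtDiffeo.transitionIso (g : ExtDiffeo n M) {p q : M} {y : EuclideanSpace ℝ (Fin (2 * n))}
    (hy : y ∈ transitionDomain g.F p q) :
    ExtIso (EuclideanSpace ℝ (Fin (2 * n))) (EuclideanSpace ℝ (Fin (2 * n))) :=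
  ((ExtIso.ofEquiv (chartEquiv ((extChartAt (𝓡 (2 * n)) p).map_target hy.1)).symm).trans
    (g.tangentIso _)).trans (ExtIso.ofEquiv (chartEquiv hy.2))

theorem ExtDiffeo.transitionIso_equiv (g : ExtDiffeo n M) {p q : M}
    {y : EuclideanSpace ℝ (Fin (2 * n))} (hy : y ∈ transitionDomain g.F p q) :
    (g.transitionIso hy).equiv.toLinearMap = (fderiv ℝ (transition g.F p q) y).toLinearMap := by
  have hp : MDifferentiableAt 𝓘(ℝ, EuclideanSpace ℝ (Fin (2 * n))) (𝓡 (2 * n))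
      (extChartAt (𝓡 (2 * n)) p).symm y := by
    have h := mdifferentiableWithinAt_extChartAt_symm (I := 𝓡 (2 * n)) hy.1
    rwa [ModelWithCorners.Boundaryless.range_eq_univ, mdifferentiableWithinAt_univ] at h
  have hF : MDifferentiableAt (𝓡 (2 * n)) (𝓡 (2 * n)) g.F ((extChartAt (𝓡 (2 * n)) p).symm y) :=
    g.F.mdifferentiable (by simp) _
  have hq : MDifferentiableAt (𝓡 (2 * n)) 𝓘(ℝ, EuclideanSpace ℝ (Fin (2 * n)))
      (extChartAt (𝓡 (2 * n)) q) ((g.F ∘ (extChartAt (𝓡 (2 * n)) p).symm) y) := by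
    refine mdifferentiableAt_extChartAt ?_
    rw [← extChartAt_source (𝓡 (2 * n))]
    exact hy.2
  have hchain : fderiv ℝ (transition g.F p q) y = _ :=
    (mfderiv_eq_fderiv (f := transition g.F p q) (x := y)).symm.trans
      ((mfderiv_comp y hq (hF.comp y hp)).trans (congrArg _ (mfderiv_comp y hF hp)))
  change (chartEquiv hy.2).toLinearMap ∘ₗ (tangentEquiv g.F _).toLinearMap ∘ₗ
    (chartEquiv ((extChartAt (𝓡 (2 * n)) p).map_target hy.1)).symm.toLinearMap = _
  rw [hchain, chartEquiv_symm_toLinearMap hy.1, tangentEquiv_toLinearMap]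
  rfl

theorem ExtDiffeo.transitionIso_b (g : ExtDiffeo n M) {p q : M}
    {y : EuclideanSpace ℝ (Fin (2 * n))} (hy : y ∈ transitionDomain g.F p q) :
    (g.transitionIso hy).b = g.bInChart p y := by
  rw [bInChart, ← chartEquiv_symm_toLinearMap hy.1]
  exact (congrArg₂ (· + ·) (zero_add _) (map_zero _)).trans (add_zero _)

theorem ExtDiffeo.fderiv_transition (g : ExtDiffeo n M) {p q : M}
    {y : EuclideanSpace ℝ (Fin (2 * n))} (hy : y ∈ transitionDomain g.F p q) :
    fderiv ℝ (transition g.F p q) y = (g.transitionIso hy).equiv.toContinuousLinearEquiv :=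
  ContinuousLinearMap.coe_injective (g.transitionIso_equiv hy).symm

theorem ExtDiffeo.transitionIso_equiv_symm (g : ExtDiffeo n M) {p q : M}
    {y : EuclideanSpace ℝ (Fin (2 * n))} (hy : y ∈ transitionDomain g.F p q) :
    (g.transitionIso hy).equiv.symm.toLinearMap =
      (fderiv ℝ (transition g.F p q) y).inverse.toLinearMap := by
  rw [g.fderiv_transition hy, ContinuousLinearMap.inverse_equiv]
  rfl

theorem contDiffOn_fderiv_transition (F : M ≃ₘ⟮𝓡 (2 * n), 𝓡 (2 * n)⟯ M) (p q : M) :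
    ContDiffOn ℝ ∞ (fderiv ℝ (transition F p q)) (transitionDomain F p q) :=
  (contDiffOn_transition F p q).fderiv_of_isOpen (isOpen_transitionDomain F p q) (by norm_cast)

theorem ExtDiffeo.contDiffOn_inverse_fderiv_transition (g : ExtDiffeo n M) (p q : M) :
    ContDiffOn ℝ ∞ (fun y => (fderiv ℝ (transition g.F p q) y).inverse)
      (transitionDomain g.F p q) := by
  intro y hy
  have hinverse : ContDiffAt ℝ ∞ ContinuousLinearMap.inverse
      (fderiv ℝ (transition g.F p q) y) := by
    rw [g.fderiv_transition hy]
    exact contDiffAt_map_inverse _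
  exact hinverse.comp_contDiffWithinAt y (contDiffOn_fderiv_transition g.F p q y hy)

theorem ExtDiffeo.inChart_smul (g : ExtDiffeo n M) (τ : CField n M) {p q : M}
    {y : EuclideanSpace ℝ (Fin (2 * n))} (hy : y ∈ transitionDomain g.F p q) :
    inChart (g.smul τ) p y =
      (g.transitionIso hy).spin (inChart τ q (transition g.F p q y)) := by
  have hcancel := (ExtIso.ofEquiv (chartEquiv hy.2).symm).spin_symm_spin (τ _)
  rw [ExtIso.symm_ofEquiv, LinearEquiv.symm_symm] at hcancel
  rw [transition, inChart_eq_spin τ hy.2 ((extChartAt (𝓡 (2 * n)) q).map_source hy.2)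
    ((extChartAt (𝓡 (2 * n)) q).left_inv hy.2), transitionIso, ExtIso.spin_trans,
    ExtIso.spin_trans, hcancel,
    inChart_eq_spin _ ((extChartAt (𝓡 (2 * n)) p).map_target hy.1) hy.1 rfl]
  exact congrArg _ (g.smul_apply τ _)

theorem ExtDiffeo.gtInChart_gtSmul (g : ExtDiffeo n M) (e : GTField n M) {p q : M}
    {y : EuclideanSpace ℝ (Fin (2 * n))} (hy : y ∈ transitionDomain g.F p q) :
    gtInChart (g.gtSmul e) p y =
      (g.transitionIso hy).gtC (gtInChart e q (transition g.F p q y)) := by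
  have hcancel := (ExtIso.ofEquiv (chartEquiv hy.2).symm).gtC_symm_gtC (e _)
  rw [ExtIso.symm_ofEquiv, LinearEquiv.symm_symm] at hcancel
  rw [transition, gtInChart_eq_gtC e hy.2 ((extChartAt (𝓡 (2 * n)) q).map_source hy.2)
    ((extChartAt (𝓡 (2 * n)) q).left_inv hy.2), transitionIso, ExtIso.gtC_trans,
    ExtIso.gtC_trans, hcancel,
    gtInChart_eq_gtC _ ((extChartAt (𝓡 (2 * n)) p).map_target hy.1) hy.1 rfl, gtSmul]

theorem FormSmoothOn.smul {U : Set M} {τ : CField n M} (hτ : FormSmoothOn U τ)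
    (g : ExtDiffeo n M) : FormSmoothOn (g.F ⁻¹' U) (g.smul τ) := by
  refine fun p => smoothOn_of_transitionDomain g.F fun q => ?_
  have hsub : transitionDomain g.F p q ∩ chartDomain n p (g.F ⁻¹' U) ⊆ transitionDomain g.F p q :=
    Set.inter_subset_left
  have hτq := (hτ q).comp ((contDiffOn_transition g.F p q).mono hsub) (mapsTo_transition g.F p q U)
  have hb := ((g.smoothOn_bInChart p).exp fun y _ => g.bInChart_mem p y).mono
    fun y hy => (hsub hy).1
  have hF := smoothOn_toLinearMap ((contDiffOn_fderiv_transition g.F p q).mono hsub)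
  refine ((smoothOn_ofR.mpr hb).mul (hF.pullC hτq)).congr fun y hy => ?_
  rw [g.inChart_smul τ hy.1, ExtIso.spin_apply, g.transitionIso_b, g.transitionIso_equiv]

theorem GTSmoothOn.gtSmul {U : Set M} {e : GTField n M} (he : GTSmoothOn U e)
    (g : ExtDiffeo n M) : GTSmoothOn (g.F ⁻¹' U) (g.gtSmul e) := by
  refine fun p => smoothOn_of_transitionDomain g.F fun q => ?_
  have hsub : transitionDomain g.F p q ∩ chartDomain n p (g.F ⁻¹' U) ⊆ transitionDomain g.F p q :=
    Set.inter_subset_left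
  have heq := (he q).comp ((contDiffOn_transition g.F p q).mono hsub) (mapsTo_transition g.F p q U)
  have hb := (g.smoothOn_bInChart p).bShift.mono fun y hy => (hsub hy).1
  have hF := (smoothOn_toLinearMap ((contDiffOn_fderiv_transition g.F p q).mono hsub)).gtPull
    (smoothOn_toLinearMap ((g.contDiffOn_inverse_fderiv_transition p q).mono hsub))
  refine (hb.baseChange (hF.baseChange heq)).congr fun y hy => ?_
  rw [g.gtInChart_gtSmul e hy.1, ExtIso.gtC_apply, ExtIso.gtMap, g.transitionIso_b,
    g.transitionIso_equiv, g.transitionIso_equiv_symm, baseChange_baseChange]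

end ExtDiffeo

section Locality

theorem dirDeriv_congr {E : Type*} [NormedAddCommGroup E] [NormedSpace ℝ E] {P : Type*}
    [AddCommGroup P] [Module ℝ P] [Module.Finite ℝ P] {f g : E → P} {y : E}
    (h : f =ᶠ[nhds y] g) (v : E) : dirDeriv f y v = dirDeriv g y v := by
  have hcoord (i) : (fun z => (Module.finBasis ℝ P).repr (f z) i) =ᶠ[nhds y]
      fun z => (Module.finBasis ℝ P).repr (g z) i :=
    h.fun_comp fun p => (Module.finBasis ℝ P).repr p i
  simp only [dirDeriv, (hcoord _).fderiv_eq]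

theorem extD_congr {m : ℕ} {σ τ : EuclideanSpace ℝ (Fin m) → CForm (EuclideanSpace ℝ (Fin m))}
    {y : EuclideanSpace ℝ (Fin m)} (h : σ =ᶠ[nhds y] τ) : extD σ y = extD τ y := by
  simp only [extD, dirDeriv_congr h]

variable {n : ℕ} {M : Type*} [TopologicalSpace M] [ChartedSpace (EuclideanSpace ℝ (Fin (2 * n))) M]
  {σ τ : CField n M} {x : M}

theorem inChart_congr (h : ∀ᶠ z in nhds x, σ z = τ z) :
    inChart σ x =ᶠ[nhds (extChartAt (𝓡 (2 * n)) x x)] inChart τ x := by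
  have hcont := continuousAt_extChartAt_symm (I := 𝓡 (2 * n)) x
  rw [ContinuousAt, extChartAt_to_inv x] at hcont
  filter_upwards [hcont.eventually h] with y hy
  rw [inChart, inChart, hy]

theorem dTw_congr (H : RField n M) (h : ∀ᶠ z in nhds x, σ z = τ z) :
    dTw H σ x = dTw H τ x := by
  rw [dTw, dTw, d, d, extD_congr (inChart_congr h), h.self_of_nhds]

variable [IsManifold (𝓡 (2 * n)) ∞ M] [T2Space M]

theorem FormSmoothOn.bump_smul {U : Set M} (hU : IsOpen U) (hτ : FormSmoothOn U τ)
    (f : SmoothBumpFunction (𝓡 (2 * n)) x) (hf : tsupport f ⊆ U) :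
    FormSmoothOn Set.univ (fun z => f z • τ z) := by
  intro p
  have hsmul (y) : inChart (fun z => f z • τ z) p y =
      f ((extChartAt (𝓡 (2 * n)) p).symm y) • inChart τ p y :=
    LinearMap.map_smul_of_tower _ _ _
  refine smoothOn_chartDomain_of_locally fun z _ => ?_
  by_cases hz : z ∈ U
  · refine ⟨U, hU, hz, ?_⟩
    rw [Set.univ_inter]
    have hf' : ContDiffOn ℝ ∞ (fun y => f ((extChartAt (𝓡 (2 * n)) p).symm y))
        (chartDomain n p U) := by
      rw [← contMDiffOn_iff_contDiffOn]
      exact f.contMDiff.comp_contMDiffOn ((contMDiffOn_extChartAt_symm p).mono fun y hy => hy.1)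
    exact (SmoothOn.smul hf' (hτ p)).congr fun y _ => hsmul y
  · refine ⟨(tsupport f)ᶜ, (isClosed_tsupport f).isOpen_compl, fun hz' => hz (hf hz'), ?_⟩
    refine (smoothOn_const 0).congr fun y hy => ?_
    rw [hsmul, image_eq_zero_of_notMem_tsupport hy.2.2, zero_smul]

theorem FormSmoothOn.exists_global {U : Set M} (hU : IsOpen U) (hx : x ∈ U)
    (hτ : FormSmoothOn U τ) :
    ∃ σ : CField n M, FormSmoothOn Set.univ σ ∧ ∀ᶠ z in nhds x, σ z = τ z := by
  obtain ⟨f, -, hf⟩ := (SmoothBumpFunction.nhds_basis_tsupport (I := 𝓡 (2 * n)) x).mem_iff.mp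
    (hU.mem_nhds hx)
  refine ⟨fun z => f z • τ z, hτ.bump_smul hU f hf, ?_⟩
  filter_upwards [f.eventuallyEq_one] with z hz
  rw [hz, Pi.one_apply, one_smul]

end Locality

section Equivariance

variable {n : ℕ} {M : Type*} [TopologicalSpace M] [ChartedSpace (EuclideanSpace ℝ (Fin (2 * n))) M]

namespace ExtDiffeo

/-- The action of `g = e^b F` on fields of endomorphisms of `T ⊕ T^*`. -/
def jSmul (g : ExtDiffeo n M) (J : JField n M) : JField n M := fun x =>
  (g.tangentIso x).gt.toLinearEquiv.conj (J (g.F x))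

/-- `g` commutes with `d_H` on globally defined smooth forms. -/
def CommutesWithDTw (g : ExtDiffeo n M) (H : RField n M) : Prop :=
  ∀ τ : CField n M, FormSmoothOn Set.univ τ → dTw H (g.smul τ) = g.smul (dTw H τ)

variable (g : ExtDiffeo n M)

theorem conjF_smul (τ : CField n M) : conjF (g.smul τ) = g.smul (conjF τ) := by
  funext x
  rw [smul_apply, conjF, smul_apply, ExtIso.conjC_spin, conjF]

theorem actF_gtSmul_smul (e : GTField n M) (τ : CField n M) :
    actF (g.gtSmul e) (g.smul τ) = g.smul (actF e τ) := by
  funext x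
  rw [smul_apply, actF, smul_apply]
  exact ((g.tangentIso x).spin_act _ _).symm

theorem conjC_gtSmul (e : GTField n M) (x : M) :
    conjC _ (g.gtSmul e x) = (g.tangentIso x).gtC (conjC _ (e (g.F x))) :=
  (g.tangentIso x).conjC_gtC _

theorem pairingC_gtSmul (e f : GTField n M) (x : M) :
    pairingC (g.gtSmul e x) (g.gtSmul f x) = pairingC (e (g.F x)) (f (g.F x)) :=
  (g.tangentIso x).pairingC_gtC _ _

theorem spinPairing_smul (σ τ : CField n M) (x : M) :
    spinPairing (g.smul σ x) (g.smul τ x) =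
      pullC (tangentEquiv g.F x).toLinearMap (spinPairing (σ (g.F x)) (τ (g.F x))) := by
  rw [smul_apply, smul_apply, ExtIso.spinPairing_spin, tangentIso]

theorem smul_eq_act_add_spinC {σ τ : CField n M} {e : GTField n M} {x : M}
    {N : CliffordAlgebra (QuadraticForm.dualProd ℝ (T n (g.F x)))}
    (h : σ (g.F x) = act (e (g.F x)) (τ (g.F x)) + spinC N (τ (g.F x))) :
    g.smul σ x = act (g.gtSmul e x) (g.smul τ x) +
      spinC (CliffordAlgebra.map (g.tangentIso x).gt.toIsometry N) (g.smul τ x) := by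
  rw [smul_apply, smul_apply, h]
  exact (g.tangentIso x).spin_act_add_spinC _ _ _

theorem spinPairing_smul_conjC_smul (τ : CField n M) (x : M) (c : ℂ) :
    c • spinPairing (g.smul τ x) (conjC _ (g.smul τ x)) = pullC (tangentEquiv g.F x).toLinearMap
      (c • spinPairing (τ (g.F x)) (conjC _ (τ (g.F x)))) := by
  have h := g.spinPairing_smul τ (conjF τ) x
  rw [← conjF_smul] at h
  rw [map_smul]
  exact congrArg (c • ·) h

end ExtDiffeo

variable [IsManifold (𝓡 (2 * n)) ∞ M]

theorem IsTrivialization.smul {U : Set M} {φ : CField n M} {J : JField n M} {vol : RField n M}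
    (h : IsTrivialization U φ J vol) (g : ExtDiffeo n M) :
    IsTrivialization (g.F ⁻¹' U) (g.smul φ) (g.jSmul J) (pullback g.F vol) where
  smooth := h.smooth.smul g
  pure x hx := by
    rw [g.smul_apply]
    exact (h.pure _ hx).spin _
  nondegenerate x hx := by
    rw [g.smul_apply]
    exact (h.nondegenerate _ hx).spin _
  induces x hx := by
    rw [g.smul_apply]
    exact (h.induces _ hx).spin _
  normalized x hx := by
    rw [g.spinPairing_smul_conjC_smul, h.normalized _ hx, pullC_ofR, pullback_apply]

namespace ExtDiffeo

variable [T2Space M] {g : ExtDiffeo n M} {H : RField n M} {U : Set M} {x : M}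

theorem CommutesWithDTw.dTw_smul (hg : g.CommutesWithDTw H) (hU : IsOpen U) {τ : CField n M}
    (hτ : FormSmoothOn U τ) (hx : g.F x ∈ U) : dTw H (g.smul τ) x = g.smul (dTw H τ) x := by
  obtain ⟨σ, hσ, hστ⟩ := hτ.exists_global hU hx
  have hsmul : ∀ᶠ z in nhds x, g.smul σ z = g.smul τ z := by
    filter_upwards [g.F.continuous.continuousAt.eventually hστ] with z hz
    rw [smul_apply, smul_apply, hz]
  rw [← dTw_congr H hsmul, hg σ hσ, smul_apply, smul_apply, dTw_congr H hστ]

theorem CommutesWithDTw.lieTw_gtSmul_smul (hg : g.CommutesWithDTw H) (hU : IsOpen U)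
    {e : GTField n M} (he : GTSmoothOn U e) {τ : CField n M} (hτ : FormSmoothOn U τ)
    (hx : g.F x ∈ U) : lieTw H (g.gtSmul e) (g.smul τ) x = g.smul (lieTw H e τ) x := by
  have hact : act (g.gtSmul e x) (g.smul (dTw H τ) x) = g.smul (actF e (dTw H τ)) x :=
    congrFun (g.actF_gtSmul_smul e (dTw H τ)) x
  rw [lieTw, actF_gtSmul_smul, hg.dTw_smul hU (FormSmoothOn.actF he hτ) hx,
    hg.dTw_smul hU hτ hx, hact, smul_apply, smul_apply, smul_apply, ← map_add]
  rfl

theorem CommutesWithDTw.spinPairing_lieTw_smul (hg : g.CommutesWithDTw H) (hU : IsOpen U)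
    {e : GTField n M} (he : GTSmoothOn U e) {τ : CField n M} (hτ : FormSmoothOn U τ)
    (hx : g.F x ∈ U) :
    spinPairing (g.smul τ x) (lieTw H (g.gtSmul e) (conjF (g.smul τ)) x) =
      pullC (tangentEquiv g.F x).toLinearMap
        (spinPairing (τ (g.F x)) (lieTw H e (conjF τ) (g.F x))) := by
  rw [conjF_smul, hg.lieTw_gtSmul_smul hU he hτ.conjF hx, spinPairing_smul]

theorem CommutesWithDTw.curvatureForm_smul (hg : g.CommutesWithDTw H) (hU : IsOpen U)
    {φ ψ : CField n M} (hφ : FormSmoothOn U φ) (hψ : FormSmoothOn U ψ) {η ζ : GTField n M}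
    (hη : GTSmoothOn U η) (hζ : GTSmoothOn U ζ) (vol : RField n M) (hx : g.F x ∈ U) :
    curvatureForm H (pullback g.F vol) (g.smul φ) (g.smul ψ) (g.gtSmul η) (g.gtSmul ζ) x =
      pullback g.F (curvatureForm H vol φ ψ η ζ) x := by
  refine Eq.trans ?_ ((pullback_apply _ _ _).trans
    (pullR_reC_smul_add_smul_add_smul _ _ _ _ _ _)).symm
  refine congrArg₂ (· + ·) ?_ ?_
  · exact congrArg₂ (fun ρ σ : CForm (T n x) => reC _
      ((Complex.I ^ n)⁻¹ • ρ + (Complex.I ^ n)⁻¹ • σ))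
      (hg.spinPairing_lieTw_smul hU hη hψ hx) (hg.spinPairing_lieTw_smul hU hζ hφ hx)
  · exact congrArg₂ (fun (c : ℂ) (α : RForm (T n x)) => (2 * c.re) • α) (g.pairingC_gtSmul ζ η x)
      (pullback_apply g.F vol x)

end ExtDiffeo

variable [T2Space M]

theorem IsConnectionTerm.smul {g : ExtDiffeo n M} {H : RField n M} (hg : g.CommutesWithDTw H)
    {U : Set M} (hU : IsOpen U) {φ : CField n M} (hφ : FormSmoothOn U φ) {J : JField n M}
    {η : GTField n M} (h : IsConnectionTerm H U φ J η) :
    IsConnectionTerm H (g.F ⁻¹' U) (g.smul φ) (g.jSmul J) (g.gtSmul η) where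
  smooth := GTSmoothOn.gtSmul h.smooth g
  imaginary x hx :=
    (g.conjC_gtSmul η x).trans ((congrArg _ (h.imaginary _ hx)).trans (map_neg _ _))
  eq x hx := by
    obtain ⟨N, hN, hd⟩ := h.eq _ hx
    refine ⟨CliffordAlgebra.map (g.tangentIso x).gt.toIsometry N,
      map_mem_nijenhuisSpace _ hN, ?_⟩
    exact (hg.dTw_smul hU hφ hx).trans (g.smul_eq_act_add_spinC hd)

theorem IsScalarCurvatureAt.smul {g : ExtDiffeo n M} {H : RField n M} (hg : g.CommutesWithDTw H)
    {J₁ J₂ : JField n M} {vol : RField n M} {x : M} {s : ℝ}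
    (h : IsScalarCurvatureAt H J₁ J₂ vol (g.F x) s) :
    IsScalarCurvatureAt H (g.jSmul J₁) (g.jSmul J₂) (pullback g.F vol) x s := by
  obtain ⟨U, φ, ψ, η, ζ, hU, hx, hφ, hψ, hη, hζ, hs⟩ := h
  refine ⟨g.F ⁻¹' U, g.smul φ, g.smul ψ, g.gtSmul η, g.gtSmul ζ, hU.preimage g.F.continuous, hx,
    hφ.smul g, hψ.smul g, hη.smul hg hU hφ.smooth, hζ.smul hg hU hψ.smooth, ?_⟩
  rw [hg.curvatureForm_smul hU hφ.smooth hψ.smooth hη.smooth hζ.smooth vol hx, pullback_apply,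
    pullback_apply, ← hs, map_smul]

end Equivariance

section Inverse

variable {n : ℕ} {M : Type*} [TopologicalSpace M] [ChartedSpace (EuclideanSpace ℝ (Fin (2 * n))) M]
  {k : ℕ} {α : RField n M}

theorem IsRealForm.zero (k : ℕ) : IsRealForm k (0 : RField n M) where
  degree _ := zero_mem _
  smooth p := (smoothOn_const 0).congr fun y _ => by
    change pullC (dChartInv p y) (ofR 0) = 0
    rw [pullC_ofR, map_zero, ofR, TensorProduct.tmul_zero]

theorem IsRealForm.neg (hα : IsRealForm k α) : IsRealForm k (-α) where
  degree x := neg_mem (hα.degree x)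
  smooth p := ((hα.smooth p).linear (-LinearMap.id)).congr fun y _ => by
    change pullC _ (ofR (-α _)) = -pullC _ (ofR (α _))
    rw [ofR, TensorProduct.tmul_neg, map_neg, ofR]

theorem tangentEquiv_tangentEquiv_symm (F : M ≃ₘ⟮𝓡 (2 * n), 𝓡 (2 * n)⟯ M) (y : M)
    (v : T n y) :
    (tangentEquiv F (F.symm y) (tangentEquiv F.symm y v) : EuclideanSpace ℝ (Fin (2 * n))) = v := by
  have hid : ∀ f : M → M, f = id →
      (mfderiv (𝓡 (2 * n)) (𝓡 (2 * n)) f y v : EuclideanSpace ℝ (Fin (2 * n))) = v := by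
    rintro _ rfl
    rw [mfderiv_id]
    rfl
  have hcomp := hid (F ∘ F.symm) (funext F.apply_symm_apply)
  rw [mfderiv_comp y (F.mdifferentiable (by simp) _) (F.symm.mdifferentiable (by simp) y)] at hcomp
  have hF := LinearMap.congr_fun (tangentEquiv_toLinearMap F (F.symm y)) (tangentEquiv F.symm y v)
  have hsymm := LinearMap.congr_fun (tangentEquiv_toLinearMap F.symm y) v
  refine Eq.trans hF (Eq.trans ?_ hcomp)
  exact congrArg (mfderiv (𝓡 (2 * n)) (𝓡 (2 * n)) F (F.symm y)) hsymm

namespace ExtDiffeo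

/-- A diffeomorphism, extended by the zero form. -/
def ofDiffeo (F : M ≃ₘ⟮𝓡 (2 * n), 𝓡 (2 * n)⟯ M) : ExtDiffeo n M := ⟨F, 0, IsRealForm.zero 2⟩

theorem ofDiffeo_smul_ofR (F : M ≃ₘ⟮𝓡 (2 * n), 𝓡 (2 * n)⟯ M) (α : RField n M) :
    (ofDiffeo F).smul (fun x => ofR (α x)) = fun x => ofR (pullback F α x) := by
  funext x
  rw [smul_apply, pullback_apply]
  exact ExtIso.spin_ofEquiv _ _

end ExtDiffeo

variable [IsManifold (𝓡 (2 * n)) ∞ M]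

theorem IsRealForm.pullback (hα : IsRealForm k α) (F : M ≃ₘ⟮𝓡 (2 * n), 𝓡 (2 * n)⟯ M) :
    IsRealForm k (pullback F α) where
  degree x := pullR_mem_exteriorPower _ (hα.degree _)
  smooth := by
    rw [← ExtDiffeo.ofDiffeo_smul_ofR]
    exact FormSmoothOn.smul hα.smooth (ExtDiffeo.ofDiffeo F)

theorem IsVolumeForm.pullback {vol : RField n M} (hvol : IsVolumeForm vol)
    (F : M ≃ₘ⟮𝓡 (2 * n), 𝓡 (2 * n)⟯ M) : IsVolumeForm (pullback F vol) where
  toIsRealForm := hvol.toIsRealForm.pullback F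
  ne_zero x h := by
    rw [pullback_apply] at h
    refine hvol.ne_zero (F x) ?_
    rw [← pullR_id (vol (F x)), ← LinearEquiv.comp_symm (tangentEquiv F x), ← pullR_comp, h,
      map_zero]

namespace ExtDiffeo

/-- The inverse of `e^b F`. -/
def inv (g : ExtDiffeo n M) : ExtDiffeo n M :=
  ⟨g.F.symm, -pullback g.F.symm g.b, (g.isForm.pullback g.F.symm).neg⟩

variable (g : ExtDiffeo n M)

/-- The tangent spaces at `y` and at `F (F⁻¹ y)` are different types, so that
`g.inv.tangentIso y` can be called the inverse of `g.tangentIso (F⁻¹ y)` only after `F (F⁻¹ y)` has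
been replaced by `y`. -/
theorem tangentIso_inv_induction (y : M)
    (P : ∀ z : M, ExtIso (T n (g.F.symm y)) (T n z) → ExtIso (T n y) (T n (g.F.symm y)) → Prop)
    (h : ∀ e : ExtIso (T n (g.F.symm y)) (T n y), P y e e.symm) :
    P (g.F (g.F.symm y)) (g.tangentIso (g.F.symm y)) (g.inv.tangentIso y) := by
  have key : ∀ (z : M) (e : ExtIso (T n (g.F.symm y)) (T n z))
      (e' : ExtIso (T n y) (T n (g.F.symm y))), z = y →
      (∀ v : T n y, (e.equiv (e'.equiv v) : EuclideanSpace ℝ (Fin (2 * n))) = v) →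
      e'.b = -pullR e'.equiv.toLinearMap e.b → P z e e' := by
    rintro z e e' rfl hequiv hb
    have hequiv' : e'.equiv = e.equiv.symm :=
      LinearEquiv.ext fun v => (LinearEquiv.eq_symm_apply e.equiv).mpr (hequiv v)
    have he' : e' = e.symm := ExtIso.ext hequiv' (hb.trans (by rw [hequiv', ExtIso.symm]))
    exact he' ▸ h e
  exact key _ _ _ (g.F.apply_symm_apply y) (tangentEquiv_tangentEquiv_symm g.F y)
    (congrArg Neg.neg (pullback_apply _ _ _))

theorem pullback_inv_pullback (α : RField n M) : pullback g.inv.F (pullback g.F α) = α := by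
  funext y
  rw [pullback_apply, pullback_apply]
  refine g.tangentIso_inv_induction y
    (fun z e e' => pullR e'.equiv.toLinearMap (pullR e.equiv.toLinearMap (α z)) = α y) fun e => ?_
  rw [pullR_comp]
  exact (congrArg (fun A => pullR A (α y)) (LinearEquiv.comp_symm e.equiv)).trans (pullR_id _)

theorem inv_smul_smul (τ : CField n M) : g.inv.smul (g.smul τ) = τ := by
  funext y
  rw [smul_apply, smul_apply]
  exact g.tangentIso_inv_induction y (fun z e e' => e'.spin (e.spin (τ z)) = τ y)
    fun e => e.spin_symm_spin _

theorem smul_inv_smul (τ : CField n M) : g.smul (g.inv.smul τ) = τ := by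
  funext x
  obtain ⟨y, rfl⟩ := g.F.symm.surjective x
  have h := congrFun (g.inv_smul_smul (g.inv.smul τ)) y
  rw [g.inv.smul_apply (g.smul (g.inv.smul τ)) y, g.inv.smul_apply τ y] at h
  exact (g.inv.tangentIso y).spin_injective h

theorem jSmul_inv_jSmul (J : JField n M) : g.inv.jSmul (g.jSmul J) = J := by
  funext y
  refine g.tangentIso_inv_induction y
    (fun z e e' => e'.gt.toLinearEquiv.conj (e.gt.toLinearEquiv.conj (J z)) = J y) fun e => ?_
  rw [ExtIso.gt_symm]
  exact e.gt.toLinearEquiv.conj.symm_apply_apply _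

variable {g} {H : RField n M}

theorem CommutesWithDTw.inv (hg : g.CommutesWithDTw H) : g.inv.CommutesWithDTw H := by
  intro τ hτ
  have h := hg _ (hτ.smul g.inv)
  rw [smul_inv_smul] at h
  rw [h, inv_smul_smul]

end ExtDiffeo

variable [T2Space M] {g : ExtDiffeo n M} {H : RField n M}

theorem isScalarCurvatureAt_jSmul_iff (hg : g.CommutesWithDTw H) {J₁ J₂ : JField n M}
    {vol : RField n M} {x : M} {s : ℝ} :
    IsScalarCurvatureAt H (g.jSmul J₁) (g.jSmul J₂) (pullback g.F vol) x s ↔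
      IsScalarCurvatureAt H J₁ J₂ vol (g.F x) s := by
  refine ⟨fun h => ?_, fun h => h.smul hg⟩
  have hx : g.inv.F (g.F x) = x := g.F.symm_apply_apply x
  rw [← hx] at h
  have hinv := h.smul hg.inv
  rwa [g.jSmul_inv_jSmul, g.jSmul_inv_jSmul, g.pullback_inv_pullback] at hinv

theorem scalarCurvature_jSmul (hg : g.CommutesWithDTw H) (J₁ J₂ : JField n M) (vol : RField n M)
    (x : M) : scalarCurvature H (g.jSmul J₁) (g.jSmul J₂) (pullback g.F vol) x =
      scalarCurvature H J₁ J₂ vol (g.F x) :=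
  congrArg Classical.epsilon (funext fun _ => propext (isScalarCurvatureAt_jSmul_iff hg))

end Inverse
end GenKahler

end

theorem mainTheorem8_general {n : ℕ} {M : Type*} [TopologicalSpace M] [T2Space M]
    [ChartedSpace (EuclideanSpace ℝ (Fin (2 * n))) M] [IsManifold (𝓡 (2 * n)) ∞ M]
    (vol : GenKahler.RField n M) (hvol : GenKahler.IsVolumeForm vol) (H : GenKahler.RField n M)
    (J₁ J₂ : GenKahler.JField n M) (hJ : ∀ x, GenKahler.IsAlmostGK (J₁ x) (J₂ x))
    {ι : Type*} (U : ι → Set M) (hU : ∀ a, IsOpen (U a)) (hcover : ⋃ a, U a = Set.univ)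
    (φ ψ : ι → GenKahler.CField n M)
    (hφ : ∀ a, GenKahler.IsTrivialization (U a) (φ a) J₁ vol)
    (hψ : ∀ a, GenKahler.IsTrivialization (U a) (ψ a) J₂ vol)
    (g : GenKahler.ExtDiffeo n M) (hg : g.CommutesWithDTw H) :
    GenKahler.IsVolumeForm (GenKahler.pullback g.F vol) ∧
      (∀ a, IsOpen (g.F ⁻¹' U a)) ∧ ⋃ a, g.F ⁻¹' U a = Set.univ ∧
      (∀ a, GenKahler.IsTrivialization (g.F ⁻¹' U a) (g.smul (φ a)) (g.jSmul J₁)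
        (GenKahler.pullback g.F vol)) ∧
      (∀ a, GenKahler.IsTrivialization (g.F ⁻¹' U a) (g.smul (ψ a)) (g.jSmul J₂)
        (GenKahler.pullback g.F vol)) ∧
      (∀ x, GenKahler.IsAlmostGK (g.jSmul J₁ x) (g.jSmul J₂ x)) ∧
      (fun x => GenKahler.scalarCurvature H (g.jSmul J₁) (g.jSmul J₂)
          (GenKahler.pullback g.F vol) x • GenKahler.pullback g.F vol x) =
        GenKahler.pullback g.F (fun x => GenKahler.scalarCurvature H J₁ J₂ vol x • vol x) := by
  refine ⟨hvol.pullback g.F, fun a => (hU a).preimage g.F.continuous, ?_, fun a => (hφ a).smul g,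
    fun a => (hψ a).smul g, fun x => (hJ (g.F x)).conj _, funext fun x => ?_⟩
  · rw [← Set.preimage_iUnion, hcover, Set.preimage_univ]
  · rw [GenKahler.scalarCurvature_jSmul hg, GenKahler.pullback_apply, GenKahler.pullback_apply,
      map_smul]

theorem mainTheorem8 {n : ℕ} {M : Type*} [TopologicalSpace M] [T2Space M] [CompactSpace M]
    [ChartedSpace (EuclideanSpace ℝ (Fin (2 * n))) M] [IsManifold (𝓡 (2 * n)) ∞ M]
    (vol : GenKahler.RField n M) (hvol : GenKahler.IsVolumeForm vol)
    (H : GenKahler.RField n M) (hH : GenKahler.IsClosedThreeForm H)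
    (J₁ J₂ : GenKahler.JField n M) (hJ : ∀ x, GenKahler.IsAlmostGK (J₁ x) (J₂ x))
    {ι : Type*} (U : ι → Set M) (hU : ∀ a, IsOpen (U a)) (hcover : ⋃ a, U a = Set.univ)
    (φ ψ : ι → GenKahler.CField n M)
    (hφ : ∀ a, GenKahler.IsTrivialization (U a) (φ a) J₁ vol)
    (hψ : ∀ a, GenKahler.IsTrivialization (U a) (ψ a) J₂ vol)
    (g : GenKahler.ExtDiffeo n M) (hg : g ∈ GenKahler.extDiff₀ H) :
    ∃ gJ₁ gJ₂ : GenKahler.JField n M,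
      (∀ a, GenKahler.IsTrivialization (g.F ⁻¹' U a) (g.smul (φ a)) gJ₁
        (GenKahler.pullback g.F vol)) ∧
      (∀ a, GenKahler.IsTrivialization (g.F ⁻¹' U a) (g.smul (ψ a)) gJ₂
        (GenKahler.pullback g.F vol)) ∧
      (∀ x, GenKahler.IsAlmostGK (gJ₁ x) (gJ₂ x)) ∧
      (fun x => GenKahler.scalarCurvature H gJ₁ gJ₂ (GenKahler.pullback g.F vol) x •
          GenKahler.pullback g.F vol x) =
        GenKahler.pullback g.F (fun x => GenKahler.scalarCurvature H J₁ J₂ vol x • vol x) :=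
  ⟨g.jSmul J₁, g.jSmul J₂,
    (mainTheorem8_general vol hvol H J₁ J₂ hJ U hU hcover φ ψ hφ hψ g hg.2).2.2.2⟩
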